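/- Let $X$ be a complex Banach space and let $T$ be a bounded linear operator on $X$, with dual operator $T^*$ on the dual space $X^*$. *Conventions.* $T$ has the single valued extension property (SVEP) if for every open $U\subseteq\mathbb C$ the only analytic $f:U\to X$ with $(T-z)f(z)=0$ for all $z\in U$ is $f\equiv 0$. A bounded operator $A$ on a Banach space is upper semi-Fredholm if $\dim N(A)<\infty$ and $R(A)$ is closed, lower semi-Fredholm if $\operatorname{codim}R(A)<\infty$, Fredholm if it is both; for semi-Fredholm $A$, $\operatorname{ind}(A)=\dim N(A)-\operatorname{codim}R(A)\in[-\infty,\infty]$; $A$ is Weyl if it is Fredholm with $\operatorname{ind}(A)=0$; $A$ is quasi-nilpotent if $\sigma(A)\subseteq\{0\}$. Let $H_0(T)=\{x:\lim_n\|T^nx\|^{1/n}=0\}$, and let $K(T)$ be the set of those $x$ for which there are $c>0$ and a sequence $(u_n)_{n\ge 0}$ with $u_0=x$, $Tu_{n+1}=u_n$ and $\|u_n\|\le c^n\|x\|$ for all $n$. $T$ is pseudo upper semi B-Fredholm (respectively pseudo lower semi B-Fredholm, pseudo B-Fredholm, pseudo B-Weyl, in the class $pBuW$, in the class $pBlW$)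 if $X=X_1\oplus X_2$ for closed $T$-invariant subspaces $X_1,X_2$ such that $T|_{X_2}$ is quasi-nilpotent and $T|_{X_1}$ is upper semi-Fredholm (respectively lower semi-Fredholm, Fredholm, Weyl, upper semi-Fredholm with index $\le 0$, lower semi-Fredholm with index $\ge 0$). $T$ is generalized Drazin invertible if $0$ is not an accumulation point of $\sigma(T)$. $T$ is left generalized Drazin invertible if $H_0(T)$ is closed and there is a closed $T$-invariant subspace $M$ with $X=H_0(T)\oplus M$ and $T(M)$ closed. $T$ is right generalized Drazin invertible if $K(T)$ is closed and there is a closed $T$-invariant subspace $N\subseteq H_0(T)$ with $X=K(T)\oplus N$. Let $\sigma_{pBuF}(T)$, $\sigma_{pBlF}(T)$, $\sigma_{pBF}(T)$, $\sigma_{pBW}(T)$, $\sigma_{pBuW}(T)$, $\sigma_{pBlW}(T)$, $\sigma_{gD}(T)$, $\sigma_{lgD}(T)$, $\sigma_{rgD}(T)$ be the sets of $\lambda\in\mathbb C$ such that $T-\lambda I$ is not, respectively, pseudo upper semi B-Fredholm, pseudo lower semi B-Fredholm, pseudo B-Fredholm, pseudo B-Weyl, in $pBuW$, in $pBlW$,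 generalized Drazin invertible, left generalized Drazin invertible, right generalized Drazin invertible. *Statement.* 1. If $T$ has the SVEP, then $\sigma_{lgD}(T)=\sigma_{pBuF}(T)=\sigma_{pBuW}(T)$. 2. If $T^*$ has the SVEP, then $\sigma_{rgD}(T)=\sigma_{pBlF}(T)=\sigma_{pBlW}(T)$. 3. If both $T$ and $T^*$ have the SVEP, then $$\sigma_{lgD}(T)=\sigma_{pBuF}(T)=\sigma_{pBuW}(T)=\sigma_{rgD}(T)=\sigma_{pBlF}(T)=\sigma_{pBlW}(T)=\sigma_{pBF}(T)=\sigma_{pBW}(T)=\sigma_{gD}(T).$$ -/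

import Mathlib

open Filter Topology

namespace PseudoBFredholm

noncomputable section

section Operators

variable {X : Type*} [NormedAddCommGroup X] [NormedSpace ℂ X]

/-! ### The single valued extension property -/

/-- `T` has the SVEP at `μ`: for every open neighbourhood `U` of `μ`, the only analytic function
`f` on `U` with `(T - z) f(z) = 0` for all `z ∈ U` is the zero function. -/
def HasSVEPAt (T : X →L[ℂ] X) (μ : ℂ) : Prop :=
  ∀ U : Set ℂ, IsOpen U → μ ∈ U → ∀ f : ℂ → X, AnalyticOnNhd ℂ f U →
    (∀ z ∈ U, (T - z • (1 : X →L[ℂ] X)) (f z) = 0) → ∀ z ∈ U, f z = 0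

/-- `T` has the SVEP. -/
def HasSVEP (T : X →L[ℂ] X) : Prop :=
  ∀ μ : ℂ, HasSVEPAt T μ

/-- The adjoint `T* : X* → X*`, `φ ↦ φ ∘ T`, on the topological dual. -/
def adjointOp (T : X →L[ℂ] X) : StrongDual ℂ X →L[ℂ] StrongDual ℂ X :=
  ContinuousLinearMap.precomp ℂ T

/-! ### Quasi-nilpotent part and analytic core -/

theorem tendsto_root_iff (a : ℕ → ℝ) (ha : ∀ n, 0 ≤ a n) :
    Tendsto (fun n : ℕ => a n ^ ((n : ℝ)⁻¹)) atTop (𝓝 0) ↔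
      ∀ ε : ℝ, 0 < ε → ∀ᶠ n : ℕ in atTop, a n ≤ ε ^ n := by
  have key : ∀ ε : ℝ, 0 < ε → ∀ n : ℕ, 1 ≤ n → (a n ^ ((n : ℝ)⁻¹) ≤ ε ↔ a n ≤ ε ^ n) := by
    intro ε hε n hn
    have hn' : (0 : ℝ) < n := by exact_mod_cast hn
    rw [Real.rpow_inv_le_iff_of_pos (ha n) hε.le hn', Real.rpow_natCast]
  constructor
  · intro h ε hε
    filter_upwards [h.eventually (gt_mem_nhds hε), eventually_ge_atTop 1] with n h1 h2
    exact (key ε hε n h2).1 h1.le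
  · intro h
    rw [Metric.tendsto_nhds]
    intro ε hε
    filter_upwards [h (ε / 2) (half_pos hε), eventually_ge_atTop 1] with n h1 h2
    have := (key _ (half_pos hε) n h2).2 h1
    rw [Real.dist_eq, sub_zero, abs_of_nonneg (Real.rpow_nonneg (ha n) _)]
    linarith

/-- The quasi-nilpotent part `H₀(T) = {x : lim ‖Tⁿ x‖^(1/n) = 0}`. -/
def quasinilpotentPart (T : X →L[ℂ] X) : Submodule ℂ X where
  carrier := {x | Tendsto (fun n : ℕ => ‖(T ^ n) x‖ ^ ((n : ℝ)⁻¹)) atTop (𝓝 0)}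
  zero_mem' := by
    rw [Set.mem_ofPred_eq, tendsto_root_iff _ (fun _ => norm_nonneg _)]
    intro ε hε
    exact Eventually.of_forall fun n => by simpa using (pow_pos hε n).le
  add_mem' := by
    intro x y hx hy
    rw [Set.mem_ofPred_eq, tendsto_root_iff _ (fun _ => norm_nonneg _)] at hx hy ⊢
    intro ε hε
    filter_upwards [hx (ε / 2) (half_pos hε), hy (ε / 2) (half_pos hε),
      eventually_ge_atTop 1] with n h1 h2 h3
    have h4 : (1 / 2 : ℝ) ^ n ≤ 1 / 2 := by
      simpa using pow_le_pow_of_le_one (by norm_num : (0 : ℝ) ≤ 1 / 2) (by norm_num) h3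
    have h5 : (ε / 2) ^ n = (1 / 2 : ℝ) ^ n * ε ^ n := by rw [← mul_pow]; congr 1; ring
    have h6 := mul_le_mul_of_nonneg_right h4 (pow_pos hε n).le
    calc ‖(T ^ n) (x + y)‖ ≤ ‖(T ^ n) x‖ + ‖(T ^ n) y‖ := by
          rw [map_add]; exact norm_add_le _ _
      _ ≤ ε ^ n := by linarith
  smul_mem' := by
    intro c x hx
    rw [Set.mem_ofPred_eq, tendsto_root_iff _ (fun _ => norm_nonneg _)] at hx ⊢
    intro ε hε
    have hc : 0 < ‖c‖ + 1 := by positivity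
    filter_upwards [hx (ε / (‖c‖ + 1)) (by positivity), eventually_ge_atTop 1] with n h1 h2
    have h3 : ‖c‖ + 1 ≤ (‖c‖ + 1) ^ n :=
      le_self_pow₀ (by linarith [norm_nonneg c]) (by omega)
    rw [map_smul, norm_smul]
    rw [div_pow, le_div_iff₀ (by positivity)] at h1
    have h4 : ‖c‖ ≤ (‖c‖ + 1) ^ n := by linarith
    have h5 := mul_le_mul_of_nonneg_left h4 (norm_nonneg ((T ^ n) x))
    linarith [mul_comm ‖c‖ ‖(T ^ n) x‖]

/-- The analytic core `K(T)`: all `x` for which there are `c > 0` and a sequence `(uₙ)` with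
`u₀ = x`, `T uₙ₊₁ = uₙ` and `‖uₙ‖ ≤ cⁿ ‖x‖` for all `n`. -/
def analyticCore (T : X →L[ℂ] X) : Submodule ℂ X where
  carrier := {x | ∃ c : ℝ, 0 < c ∧ ∃ u : ℕ → X, u 0 = x ∧ (∀ n, T (u (n + 1)) = u n) ∧
    ∀ n, ‖u n‖ ≤ c ^ n * ‖x‖}
  zero_mem' := ⟨1, one_pos, fun _ => 0, rfl, fun _ => by simp, fun _ => by simp⟩
  add_mem' := by
    rintro x y ⟨c, hc, u, hu0, hu, hub⟩ ⟨d, hd, v, hv0, hv, hvb⟩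
    by_cases hxy : x + y = 0
    · rw [hxy]
      exact ⟨1, one_pos, fun _ => 0, rfl, fun _ => by simp, fun _ => by simp⟩
    have hpos : 0 < ‖x + y‖ := norm_pos_iff.2 hxy
    set M : ℝ := (‖x‖ + ‖y‖) / ‖x + y‖ with hM
    have hM1 : 1 ≤ M := by rw [hM, le_div_iff₀ hpos, one_mul]; exact norm_add_le x y
    have hMe : M * ‖x + y‖ = ‖x‖ + ‖y‖ := div_mul_cancel₀ _ hpos.ne'
    refine ⟨(c + d) * M, by positivity, fun n => u n + v n, by simp only [hu0, hv0],
      fun n => by rw [map_add, hu, hv], fun n => ?_⟩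
    rcases Nat.eq_zero_or_pos n with rfl | hn
    · simp [hu0, hv0]
    have h1 : c ^ n ≤ (c + d) ^ n := pow_le_pow_left₀ hc.le (by linarith) n
    have h2 : d ^ n ≤ (c + d) ^ n := pow_le_pow_left₀ hd.le (by linarith) n
    have h3 : M ≤ M ^ n := le_self_pow₀ hM1 (by omega)
    calc ‖u n + v n‖ ≤ ‖u n‖ + ‖v n‖ := norm_add_le _ _
      _ ≤ c ^ n * ‖x‖ + d ^ n * ‖y‖ := add_le_add (hub n) (hvb n)
      _ ≤ (c + d) ^ n * ‖x‖ + (c + d) ^ n * ‖y‖ := by gcongr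
      _ = (c + d) ^ n * (M * ‖x + y‖) := by rw [hMe]; ring
      _ ≤ (c + d) ^ n * (M ^ n * ‖x + y‖) := by gcongr
      _ = ((c + d) * M) ^ n * ‖x + y‖ := by rw [mul_pow]; ring
  smul_mem' := by
    rintro a x ⟨c, hc, u, hu0, hu, hub⟩
    refine ⟨c, hc, fun n => a • u n, by simp only [hu0], fun n => by rw [map_smul, hu], fun n => ?_⟩
    rw [norm_smul, norm_smul]
    have := mul_le_mul_of_nonneg_left (hub n) (norm_nonneg a)
    linarith [mul_left_comm ‖a‖ (c ^ n) ‖x‖]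

/-! ### Semi-Fredholm operators -/

/-- Finite-dimensional kernel and closed range. -/
def IsUpperSemiFredholm (T : X →L[ℂ] X) : Prop :=
  FiniteDimensional ℂ T.ker ∧ IsClosed (T.range : Set X)

/-- Range of finite codimension. -/
def IsLowerSemiFredholm (T : X →L[ℂ] X) : Prop :=
  FiniteDimensional ℂ (X ⧸ T.range)

/-- The index `dim N(T) - codim R(T)` with values in `[-∞, ∞]`; it is used only for semi-Fredholm
operators, where at least one of the two terms is finite. -/
def index (T : X →L[ℂ] X) : EReal :=
  (((Cardinal.toENat (Module.rank ℂ T.ker) : ℕ∞) : ENNReal) : EReal) -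
    (((Cardinal.toENat (Module.rank ℂ (X ⧸ T.range)) : ℕ∞) : ENNReal) : EReal)

/-- A Weyl operator is a Fredholm operator of index zero. -/
def IsWeyl (T : X →L[ℂ] X) : Prop :=
  T.IsFredholm ∧ index T = 0

/-- Quasi-nilpotent: the spectrum is contained in `{0}`. -/
def IsQuasinilpotent (T : X →L[ℂ] X) : Prop :=
  spectralRadius ℂ T = 0

/-! ### Direct sums with a quasi-nilpotent operator -/

/-- `X = X₁ ⊕ X₂` with closed `T`-invariant subspaces such that `T|X₁` has the property `P` and
`T|X₂` is quasi-nilpotent. -/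
def IsSumWithQuasinilpotent (P : ∀ M : Submodule ℂ X, (M →L[ℂ] M) → Prop)
    (T : X →L[ℂ] X) : Prop :=
  ∃ (X₁ X₂ : Submodule ℂ X) (h₁ : ∀ x ∈ X₁, T x ∈ X₁) (h₂ : ∀ x ∈ X₂, T x ∈ X₂),
    IsClosed (X₁ : Set X) ∧ IsClosed (X₂ : Set X) ∧ IsCompl X₁ X₂ ∧
      P X₁ (T.restrict h₁) ∧ IsQuasinilpotent (T.restrict h₂)

def IsPseudoUpperSemiBFredholm : (X →L[ℂ] X) → Prop :=
  IsSumWithQuasinilpotent fun _ A => IsUpperSemiFredholm A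

def IsPseudoLowerSemiBFredholm : (X →L[ℂ] X) → Prop :=
  IsSumWithQuasinilpotent fun _ A => IsLowerSemiFredholm A

/-- The class `pBuW(X)`. -/
def IsPseudoUpperSemiBWeyl : (X →L[ℂ] X) → Prop :=
  IsSumWithQuasinilpotent fun _ A => IsUpperSemiFredholm A ∧ index A ≤ 0

/-- The class `pBlW(X)`. -/
def IsPseudoLowerSemiBWeyl : (X →L[ℂ] X) → Prop :=
  IsSumWithQuasinilpotent fun _ A => IsLowerSemiFredholm A ∧ 0 ≤ index A

def IsPseudoBFredholm : (X →L[ℂ] X) → Prop :=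
  IsSumWithQuasinilpotent fun _ A => A.IsFredholm

def IsPseudoBWeyl : (X →L[ℂ] X) → Prop :=
  IsSumWithQuasinilpotent fun _ A => IsWeyl A

/-! ### Generalized Drazin invertibility -/

/-- `0` is not an accumulation point of the spectrum. -/
def IsGenDrazinInvertible (T : X →L[ℂ] X) : Prop :=
  ¬ AccPt (0 : ℂ) (𝓟 (spectrum ℂ T))

/-- `H₀(T)` is closed and has a closed `T`-invariant complement `M` with `T(M)` closed. -/
def IsLeftGenDrazinInvertible (T : X →L[ℂ] X) : Prop :=
  IsClosed (quasinilpotentPart T : Set X) ∧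
    ∃ M : Submodule ℂ X, IsClosed (M : Set X) ∧ (∀ x ∈ M, T x ∈ M) ∧
      IsCompl (quasinilpotentPart T) M ∧ IsClosed (T '' (M : Set X))

/-- `K(T)` is closed and has a closed `T`-invariant complement `N` with `N ⊆ H₀(T)`. -/
def IsRightGenDrazinInvertible (T : X →L[ℂ] X) : Prop :=
  IsClosed (analyticCore T : Set X) ∧
    ∃ N : Submodule ℂ X, IsClosed (N : Set X) ∧ (∀ x ∈ N, T x ∈ N) ∧
      IsCompl (analyticCore T) N ∧ N ≤ quasinilpotentPart T

/-! ### Spectra -/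

/-- The set of all `μ ∈ ℂ` such that `T - μ I` is not in the class `P`. -/
def spectrumOf (P : (X →L[ℂ] X) → Prop) (T : X →L[ℂ] X) : Set ℂ :=
  {μ : ℂ | ¬ P (T - μ • (1 : X →L[ℂ] X))}

/-- The generalized Drazin spectrum. -/
def sigma_gD (T : X →L[ℂ] X) : Set ℂ := spectrumOf IsGenDrazinInvertible T

/-- The left generalized Drazin spectrum. -/
def sigma_lgD (T : X →L[ℂ] X) : Set ℂ := spectrumOf IsLeftGenDrazinInvertible T

/-- The right generalized Drazin spectrum. -/
def sigma_rgD (T : X →L[ℂ] X) : Set ℂ := spectrumOf IsRightGenDrazinInvertible T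

/-- The pseudo upper semi B-Fredholm spectrum. -/
def sigma_pBuF (T : X →L[ℂ] X) : Set ℂ := spectrumOf IsPseudoUpperSemiBFredholm T

/-- The pseudo lower semi B-Fredholm spectrum. -/
def sigma_pBlF (T : X →L[ℂ] X) : Set ℂ := spectrumOf IsPseudoLowerSemiBFredholm T

/-- The spectrum associated with the class `pBuW(X)`. -/
def sigma_pBuW (T : X →L[ℂ] X) : Set ℂ := spectrumOf IsPseudoUpperSemiBWeyl T

/-- The spectrum associated with the class `pBlW(X)`. -/
def sigma_pBlW (T : X →L[ℂ] X) : Set ℂ := spectrumOf IsPseudoLowerSemiBWeyl T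

/-- The pseudo B-Fredholm spectrum. -/
def sigma_pBF (T : X →L[ℂ] X) : Set ℂ := spectrumOf IsPseudoBFredholm T

/-- The pseudo B-Weyl spectrum. -/
def sigma_pBW (T : X →L[ℂ] X) : Set ℂ := spectrumOf IsPseudoBWeyl T

end Operators

end

end PseudoBFredholm

/-! ### The quasi-nilpotent part, the analytic core and the SVEP -/

namespace PseudoBFredholm

variable {X : Type*} [NormedAddCommGroup X] [NormedSpace ℂ X]

/-! Each class is read off from splittings X = M ⊕ E into closed invariant subspaces with E ⊆ H₀(T)
(`IsReduction`). T is left generalized Drazin invertible iff, for some splitting, T is injective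
with closed range on M; right iff T maps some M onto itself; generalized Drazin invertible iff T is
bijective on some M. This holds because E is forced to be H₀(T) in the first case and M is forced to
be K(T) in the second (`quasinilpotentPart_eq`, `analyticCore_eq`), while the third is the Riesz
decomposition. The index inequalities are then automatic, and what remains is to improve a
semi-Fredholm part to an injective or a surjective one.

The SVEP at 0 gives N(T) ∩ K(T) = 0, since a geometrically bounded backward orbit of a kernel vector
sums to an analytic solution of (T - z)f(z) = 0. Hence an upper semi-Fredholm part has finite ascent
(`exists_ascent`). If it is not injective, a Jordan chain of maximal length can be moved from M to E
(`exists_splitting`), which lowers dim N(T) ∩ M; induction ends with an injective part. For T*, the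
annihilator of E plays the role of M: finite ascent there gives finite descent of T on M, and the
same splitting reaches a surjective part.

When both T and T* have the SVEP, an injective part with closed range is surjective and a surjective
part is injective, so all classes meet in generalized Drazin invertibility. -/

theorem exists_dual_ne_zero_of_notMem {p : Submodule ℂ X} (hp : IsClosed (p : Set X)) {x : X}
    (hx : x ∉ p) : ∃ φ : StrongDual ℂ X, (∀ y ∈ p, φ y = 0) ∧ φ x ≠ 0 := by
  have hq : (p.mkQ x : X ⧸ p) ≠ 0 := by
    simpa [Submodule.Quotient.mk_eq_zero] using hx
  have := hp
  obtain ⟨ψ, hψ⟩ := SeparatingDual.exists_ne_zero (R := ℂ) hq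
  refine ⟨ψ.comp p.mkQL, fun y hy => ?_, by simpa using hψ⟩
  have : p.mkQL y = 0 := (Submodule.Quotient.mk_eq_zero p).2 hy
  simp [this]

theorem mem_quasinilpotentPart_iff {T : X →L[ℂ] X} {x : X} :
    x ∈ quasinilpotentPart T ↔ ∀ ε : ℝ, 0 < ε → ∀ᶠ n : ℕ in atTop, ‖(T ^ n) x‖ ≤ ε ^ n :=
  tendsto_root_iff _ fun _ => norm_nonneg _

/-- The gap between ε / 2 and ε absorbs any constant factor, so membership in H₀(T) can be tested up
to constants. -/
theorem eventually_mul_half_pow_le (C : ℝ) {ε : ℝ} (hε : 0 < ε) :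
    ∀ᶠ n : ℕ in atTop, C * (ε / 2) ^ n ≤ ε ^ n := by
  filter_upwards [(tendsto_pow_atTop_atTop_of_one_lt (one_lt_two (α := ℝ))).eventually_ge_atTop C]
    with n hn
  have : (2 : ℝ) ^ n * (ε / 2) ^ n = ε ^ n := by rw [← mul_pow]; congr 1; ring
  rw [← this]
  gcongr

theorem mem_quasinilpotentPart_of_bound {T : X →L[ℂ] X} {x : X}
    (h : ∀ ε : ℝ, 0 < ε → ∃ C : ℝ, ∀ᶠ n : ℕ in atTop, ‖(T ^ n) x‖ ≤ C * ε ^ n) :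
    x ∈ quasinilpotentPart T := by
  rw [mem_quasinilpotentPart_iff]
  intro ε hε
  obtain ⟨C, hC⟩ := h (ε / 2) (half_pos hε)
  filter_upwards [hC, eventually_mul_half_pow_le C hε] with n h1 h2 using h1.trans h2

theorem mem_quasinilpotentPart_of_pow_eq_zero {T : X →L[ℂ] X} {x : X} {p : ℕ}
    (h : (T ^ p) x = 0) : x ∈ quasinilpotentPart T := by
  refine mem_quasinilpotentPart_of_bound fun ε _ => ⟨0, ?_⟩
  filter_upwards [eventually_ge_atTop p] with n hn
  obtain ⟨k, rfl⟩ := Nat.exists_eq_add_of_le' hn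
  simp [pow_add, h]

/-- The definition of K(T) allows no constant besides ‖x‖. A factor D ≥ 1 goes into the base because
D ≤ Dⁿ for n ≥ 1, and at n = 0 the bound is an equality. -/
theorem mem_analyticCore_of_bound {T : X →L[ℂ] X} {u : ℕ → X} (hu : ∀ n, T (u (n + 1)) = u n)
    {C c : ℝ} (hc : 0 < c) (hb : ∀ n, ‖u n‖ ≤ C * c ^ n) : u 0 ∈ analyticCore T := by
  by_cases h0 : u 0 = 0
  · rw [h0]; exact zero_mem _
  have hpos : 0 < ‖u 0‖ := norm_pos_iff.2 h0
  set D := max 1 (C / ‖u 0‖) with hD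
  have hD1 : 1 ≤ D := le_max_left _ _
  have hDC : C ≤ D * ‖u 0‖ := (div_le_iff₀ hpos).1 (le_max_right _ _)
  refine ⟨D * c, by positivity, u, rfl, hu, fun n => ?_⟩
  rcases Nat.eq_zero_or_pos n with rfl | hn
  · simp
  have h3 : D ≤ D ^ n := le_self_pow₀ hD1 (by omega)
  calc ‖u n‖ ≤ C * c ^ n := hb n
    _ ≤ (D * ‖u 0‖) * c ^ n := by gcongr
    _ ≤ (D ^ n * ‖u 0‖) * c ^ n := by gcongr
    _ = (D * c) ^ n * ‖u 0‖ := by rw [mul_pow]; ring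

theorem pow_succ_apply (T : X →L[ℂ] X) (n : ℕ) (x : X) : (T ^ (n + 1)) x = T ((T ^ n) x) := by
  rw [pow_succ']; rfl

theorem pow_add_apply (T : X →L[ℂ] X) (m n : ℕ) (x : X) :
    (T ^ (m + n)) x = (T ^ m) ((T ^ n) x) := by
  rw [pow_add]; rfl

theorem pow_mem {T : X →L[ℂ] X} {E : Submodule ℂ X} (h : ∀ x ∈ E, T x ∈ E) (n : ℕ) {x : X}
    (hx : x ∈ E) : (T ^ n) x ∈ E := by
  induction n with
  | zero => simpa
  | succ n ih => rw [pow_succ_apply]; exact h _ ih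

theorem restrict_pow_apply {T : X →L[ℂ] X} {E : Submodule ℂ X} (h : ∀ x ∈ E, T x ∈ E) (n : ℕ)
    (x : E) : (((T.restrict h) ^ n) x : X) = (T ^ n) x := by
  induction n with
  | zero => simp
  | succ n ih =>
    rw [pow_succ', pow_succ']
    exact congrArg T ih

/-- If `E ≤ H₀(T)` is closed, then the powers of `T` decay faster than any geometric sequence
uniformly on the unit ball of `E`. -/
theorem exists_pow_bound [CompleteSpace X] {T : X →L[ℂ] X} {E : Submodule ℂ X}
    (hc : IsClosed (E : Set X)) (hE : E ≤ quasinilpotentPart T) {ε : ℝ} (hε : 0 < ε) :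
    ∃ C : ℝ, ∀ n : ℕ, ∀ x ∈ E, ‖(T ^ n) x‖ ≤ C * ε ^ n * ‖x‖ := by
  have := hc.completeSpace_coe
  -- The operators ε⁻ⁿTⁿ on E are pointwise bounded: each orbit eventually has norm at most 1, and
  -- `D` bounds the finitely many earlier terms.
  obtain ⟨C, hC⟩ := banach_steinhaus
    (g := fun n : ℕ => (((ε⁻¹ ^ n : ℝ) : ℂ) • (T ^ n).domRestrict E : E →L[ℂ] X)) (by
      intro x
      have h1 := mem_quasinilpotentPart_iff.1 (hE x.2) ε hε
      have h2 : ∀ n : ℕ, ‖(((ε⁻¹ ^ n : ℝ) : ℂ) • (T ^ n).domRestrict E : E →L[ℂ] X) x‖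
          = ε⁻¹ ^ n * ‖(T ^ n) (x : X)‖ := by
        intro n
        rw [smul_apply, norm_smul, Complex.norm_real, Real.norm_of_nonneg
          (by positivity)]
        rfl
      have h3 : ∀ᶠ n : ℕ in atTop,
          ‖(((ε⁻¹ ^ n : ℝ) : ℂ) • (T ^ n).domRestrict E : E →L[ℂ] X) x‖ ≤ 1 := by
        filter_upwards [h1] with n hn
        rw [h2, inv_pow, inv_mul_le_iff₀ (by positivity), mul_one]
        exact hn
      obtain ⟨N, hN⟩ := eventually_atTop.1 h3
      obtain ⟨D, hD⟩ := ((Finset.range N).image fun n : ℕ =>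
        ‖(((ε⁻¹ ^ n : ℝ) : ℂ) • (T ^ n).domRestrict E : E →L[ℂ] X) x‖).exists_le
      refine ⟨max 1 D, fun n => ?_⟩
      by_cases hn : N ≤ n
      · exact (hN n hn).trans (le_max_left _ _)
      · exact (hD _ (Finset.mem_image_of_mem _ (Finset.mem_range.2 (not_le.1 hn)))).trans
          (le_max_right _ _))
  refine ⟨C, fun n x hx => ?_⟩
  have h1 := (((ε⁻¹ ^ n : ℝ) : ℂ) • (T ^ n).domRestrict E : E →L[ℂ] X).le_of_opNorm_le (hC n)
    ⟨x, hx⟩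
  rw [smul_apply, norm_smul, Complex.norm_real, Real.norm_of_nonneg
    (by positivity)] at h1
  have h2 : ε⁻¹ ^ n * ‖(T ^ n) x‖ ≤ C * ‖x‖ := h1
  rw [inv_pow, inv_mul_le_iff₀ (by positivity)] at h2
  linarith

/-- Gelfand's formula turns quasi-nilpotence into decay of the norms of the powers;
`exists_pow_bound` upgrades pointwise decay to decay in norm. -/
theorem isQuasinilpotent_restrict_iff [CompleteSpace X] {T : X →L[ℂ] X} {E : Submodule ℂ X}
    (hc : IsClosed (E : Set X)) (h : ∀ x ∈ E, T x ∈ E) :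
    IsQuasinilpotent (T.restrict h) ↔ E ≤ quasinilpotentPart T := by
  have := hc.completeSpace_coe
  have key := spectrum.pow_norm_pow_one_div_tendsto_nhds_spectralRadius (T.restrict h)
  simp only [one_div] at key
  constructor
  · intro hq x hx
    rw [IsQuasinilpotent] at hq
    rw [hq] at key
    have h1 := (ENNReal.tendsto_toReal ENNReal.zero_ne_top).comp key
    have h2 : Tendsto (fun n : ℕ => ‖(T.restrict h) ^ n‖ ^ ((n : ℝ)⁻¹)) atTop (𝓝 0) := by
      refine h1.congr fun n => ?_
      simp only [Function.comp_apply]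
      rw [ENNReal.toReal_ofReal (by positivity)]
    rw [tendsto_root_iff (fun n : ℕ => ‖(T.restrict h) ^ n‖) fun _ => by positivity] at h2
    refine mem_quasinilpotentPart_of_bound fun ε hε => ⟨‖x‖, ?_⟩
    filter_upwards [h2 ε hε] with n hn
    have h3 := ((T.restrict h) ^ n).le_of_opNorm_le hn ⟨x, hx⟩
    rw [mul_comm]
    calc ‖(T ^ n) x‖ = ‖(((T.restrict h) ^ n) ⟨x, hx⟩ : E)‖ := by
          rw [← restrict_pow_apply h n ⟨x, hx⟩]; rfl
      _ ≤ _ := h3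
  · intro hE
    have h2 : Tendsto (fun n : ℕ => ‖(T.restrict h) ^ n‖ ^ ((n : ℝ)⁻¹)) atTop (𝓝 0) := by
      rw [tendsto_root_iff (fun n : ℕ => ‖(T.restrict h) ^ n‖) fun _ => by positivity]
      intro ε hε
      obtain ⟨C, hC⟩ := exists_pow_bound hc hE (half_pos hε)
      filter_upwards [eventually_mul_half_pow_le (max C 0) hε] with n hn
      refine le_trans (ContinuousLinearMap.opNorm_le_bound _ (by positivity) fun x => ?_) hn
      calc ‖((T.restrict h) ^ n) x‖ = ‖(T ^ n) (x : X)‖ := by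
            rw [← restrict_pow_apply h n x]; rfl
        _ ≤ C * (ε / 2) ^ n * ‖(x : X)‖ := hC n x x.2
        _ ≤ max C 0 * (ε / 2) ^ n * ‖(x : X)‖ := by gcongr; exact le_max_left _ _
    have h3 := ENNReal.tendsto_ofReal h2
    rw [ENNReal.ofReal_zero] at h3
    exact tendsto_nhds_unique key h3

/-- For a backward orbit (uₙ) of x put f(z) = ∑ zⁿuₙ. The series for (T - z)f(z) telescopes to Tu₀ =
0, so the SVEP gives x = f(0) = 0. On the disc of radius 1/(2c) the terms are dominated by 2⁻ⁿ‖x‖.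
-/
theorem eq_zero_of_mem_ker_of_mem_analyticCore [CompleteSpace X] {T : X →L[ℂ] X}
    (hT : HasSVEPAt T 0) {x : X} (h0 : T x = 0) (hx : x ∈ analyticCore T) : x = 0 := by
  obtain ⟨c, hc, u, rfl, hu, hb⟩ := hx
  have hb' : ∀ n : ℕ, ∀ z ∈ Metric.ball (0 : ℂ) ((2 * c)⁻¹),
      ‖z ^ n • u n‖ ≤ (1 / 2 : ℝ) ^ n * ‖u 0‖ := by
    intro n z hz
    rw [mem_ball_zero_iff] at hz
    rw [norm_smul, norm_pow]
    calc ‖z‖ ^ n * ‖u n‖ ≤ ((2 * c)⁻¹) ^ n * (c ^ n * ‖u 0‖) := by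
          gcongr; exact hb n
      _ = (1 / 2 : ℝ) ^ n * ‖u 0‖ := by
          rw [← mul_assoc, ← mul_pow]; congr 2; field_simp
  have hs : Summable fun n : ℕ => (1 / 2 : ℝ) ^ n * ‖u 0‖ :=
    (summable_geometric_of_lt_one (by norm_num) (by norm_num)).mul_right _
  have hd : DifferentiableOn ℂ (fun z : ℂ => ∑' n : ℕ, z ^ n • u n)
      (Metric.ball (0 : ℂ) ((2 * c)⁻¹)) :=
    Complex.differentiableOn_tsum_of_summable_norm hs (fun n => by fun_prop) Metric.isOpen_ball hb'
  have hmem : (0 : ℂ) ∈ Metric.ball (0 : ℂ) ((2 * c)⁻¹) := Metric.mem_ball_self (by positivity)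
  have := hT _ Metric.isOpen_ball hmem _ (hd.analyticOnNhd Metric.isOpen_ball) (by
    intro z hz
    have hsum : Summable fun n : ℕ => z ^ n • u n :=
      Summable.of_norm_bounded hs fun n => hb' n z hz
    have hsum' : Summable fun n : ℕ => T (z ^ n • u n) := hsum.mapL T
    simp only [sub_apply, smul_apply,
      one_apply_eq_self]
    rw [T.map_tsum hsum, hsum'.tsum_eq_zero_add, ← hsum.tsum_const_smul z]
    simp only [map_smul, hu, h0, smul_zero, zero_add, smul_smul, pow_succ', sub_self]) 0 hmem
  rwa [tsum_eq_single 0 (by intro n hn; simp [hn]), pow_zero, one_smul] at this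

/-- The open mapping theorem provides preimages in Z with one norm constant C; iterating this choice
gives a backward orbit bounded by Cⁿ‖x‖. -/
theorem le_analyticCore [CompleteSpace X] {T : X →L[ℂ] X} {Z : Submodule ℂ X}
    (hc : IsClosed (Z : Set X)) (h : ∀ x ∈ Z, T x ∈ Z) (hs : ∀ y ∈ Z, ∃ x ∈ Z, T x = y) :
    Z ≤ analyticCore T := by
  have := hc.completeSpace_coe
  have hsurj : Function.Surjective (T.restrict h) := by
    rintro ⟨y, hy⟩
    obtain ⟨x, hx, hxy⟩ := hs y hy
    exact ⟨⟨x, hx⟩, Subtype.ext hxy⟩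
  obtain ⟨C, hC, hpre⟩ := (T.restrict h).exists_preimage_norm_le hsurj
  choose g hg hgb using hpre
  intro x hx
  have hb : ∀ n : ℕ, ‖g^[n] ⟨x, hx⟩‖ ≤ C ^ n * ‖x‖ := by
    intro n
    induction n with
    | zero => simp
    | succ n ih =>
      rw [Function.iterate_succ_apply', pow_succ']
      calc _ ≤ C * _ := hgb _
        _ ≤ C * (C ^ n * ‖x‖) := by gcongr
        _ = _ := by ring
  refine ⟨C, hC, fun n => (g^[n] ⟨x, hx⟩ : Z), rfl, fun n => ?_, hb⟩
  have := congrArg Subtype.val (hg (g^[n] ⟨x, hx⟩))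
  simpa only [Function.iterate_succ_apply', ContinuousLinearMap.coe_restrict_apply] using this

theorem exists_mem_analyticCore_map_eq {T : X →L[ℂ] X} {x : X} (hx : x ∈ analyticCore T) :
    ∃ y ∈ analyticCore T, T y = x := by
  obtain ⟨c, hc, u, rfl, hu, hb⟩ := hx
  refine ⟨u 1, mem_analyticCore_of_bound (u := fun n => u (n + 1)) (C := c * ‖u 0‖)
    (fun n => hu _) hc fun n => ?_, hu 0⟩
  have := hb (n + 1)
  rw [pow_succ] at this
  linarith

theorem map_mem_analyticCore {T : X →L[ℂ] X} {x : X} (hx : x ∈ analyticCore T) :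
    T x ∈ analyticCore T := by
  obtain ⟨c, hc, u, rfl, hu, hb⟩ := hx
  refine mem_analyticCore_of_bound (u := fun n => T (u n)) (C := ‖T‖ * ‖u 0‖)
    (fun n => by rw [hu]) hc fun n => ?_
  calc ‖T (u n)‖ ≤ ‖T‖ * ‖u n‖ := T.le_opNorm _
    _ ≤ ‖T‖ * (c ^ n * ‖u 0‖) := by gcongr; exact hb n
    _ = _ := by ring

theorem map_mem_quasinilpotentPart {T : X →L[ℂ] X} {x : X} (hx : x ∈ quasinilpotentPart T) :
    T x ∈ quasinilpotentPart T := by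
  refine mem_quasinilpotentPart_of_bound fun ε hε => ⟨‖T‖, ?_⟩
  filter_upwards [mem_quasinilpotentPart_iff.1 hx ε hε] with n hn
  calc ‖(T ^ n) (T x)‖ = ‖T ((T ^ n) x)‖ := by
        rw [← pow_succ_apply, pow_succ]; rfl
    _ ≤ ‖T‖ * ‖(T ^ n) x‖ := T.le_opNorm _
    _ ≤ _ := by gcongr

end PseudoBFredholm

/-! ### Reductions and the splitting off of Jordan chains -/

namespace PseudoBFredholm

variable {X : Type*} [NormedAddCommGroup X] [NormedSpace ℂ X]

/-- `X = M ⊕ E` with closed `T`-invariant subspaces such that `E ≤ H₀(T)`. -/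
structure IsReduction (T : X →L[ℂ] X) (M E : Submodule ℂ X) : Prop where
  map_left : ∀ x ∈ M, T x ∈ M
  map_right : ∀ x ∈ E, T x ∈ E
  isClosed_left : IsClosed (M : Set X)
  isClosed_right : IsClosed (E : Set X)
  isCompl : IsCompl M E
  right_le : E ≤ quasinilpotentPart T

theorem isSumWithQuasinilpotent_iff [CompleteSpace X] {T : X →L[ℂ] X}
    {P : ∀ M : Submodule ℂ X, (M →L[ℂ] M) → Prop} :
    IsSumWithQuasinilpotent P T ↔
      ∃ M E : Submodule ℂ X, ∃ h : IsReduction T M E, P M (T.restrict h.map_left) := by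
  constructor
  · rintro ⟨M, E, hM, hE, hcM, hcE, hME, hP, hq⟩
    exact ⟨M, E, ⟨hM, hE, hcM, hcE, hME, (isQuasinilpotent_restrict_iff hcE hE).1 hq⟩, hP⟩
  · rintro ⟨M, E, h, hP⟩
    exact ⟨M, E, h.map_left, h.map_right, h.isClosed_left, h.isClosed_right, h.isCompl, hP,
      (isQuasinilpotent_restrict_iff h.isClosed_right h.map_right).2 h.right_le⟩

/-- The span of a Jordan chain `e, T e, …, T ^ p e` splits off as soon as there is a functional
`φ` with `φ ∘ T ^ (p + 1) = 0` and `φ (T ^ p e) ≠ 0`. -/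
theorem IsReduction.exists_splitting {T : X →L[ℂ] X} {M E : Submodule ℂ X} (h : IsReduction T M E)
    {p : ℕ} {e : X} {φ : StrongDual ℂ X} (heM : e ∈ M) (he : (T ^ (p + 1)) e = 0)
    (hφE : ∀ x ∈ E, φ x = 0) (hφ : ∀ x, φ ((T ^ (p + 1)) x) = 0) (hφe : φ ((T ^ p) e) ≠ 0) :
    ∃ M' E' : Submodule ℂ X, IsReduction T M' E' ∧ M' ≤ M ∧ E ≤ E' ∧ e ∈ E' := by
  have he' : ∀ n, p < n → (T ^ n) e = 0 := by
    intro n hn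
    obtain ⟨k, rfl⟩ := Nat.exists_eq_add_of_le' hn
    rw [pow_add_apply, he, map_zero]
  have hφ' : ∀ n, p < n → ∀ x, φ ((T ^ n) x) = 0 := by
    intro n hn x
    obtain ⟨k, rfl⟩ := Nat.exists_eq_add_of_le hn
    rw [pow_add_apply, hφ]
  let chain : (Fin (p + 1) → ℂ) →ₗ[ℂ] X :=
    Fintype.linearCombination ℂ fun k : Fin (p + 1) => (T ^ (k : ℕ)) e
  let test : X →ₗ[ℂ] (Fin (p + 1) → ℂ) :=
    LinearMap.pi fun j : Fin (p + 1) => (φ.comp (T ^ (j : ℕ))).toLinearMap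
  have chain_apply : ∀ c, chain c = ∑ k, c k • (T ^ (k : ℕ)) e := fun c =>
    Fintype.linearCombination_apply ..
  have test_apply : ∀ x j, test x j = φ ((T ^ (j : ℕ)) x) := fun x j => rfl
  -- The matrix φ(T ^ (j + k) e) vanishes for j + k > p and is nonzero for j + k = p, so it is
  -- triangular up to reversing the order. Coordinate j = p - k yields c k = 0 once all earlier
  -- coefficients vanish.
  have hinj : Function.Injective (test ∘ₗ chain) := by
    rw [← LinearMap.ker_eq_bot, LinearMap.ker_eq_bot']
    intro c hc
    have key : ∀ n : ℕ, ∀ k : Fin (p + 1), (k : ℕ) = n → c k = 0 := by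
      intro n
      induction n using Nat.strong_induction_on with
      | _ n ih =>
        intro k hk
        have h1 := congrFun hc ⟨p - k, by omega⟩
        rw [LinearMap.comp_apply, test_apply, chain_apply] at h1
        simp only [map_sum, map_smul, Pi.zero_apply] at h1
        rw [Finset.sum_eq_single k] at h1
        · rw [← pow_add_apply, Nat.sub_add_cancel (by omega)] at h1
          exact (smul_eq_zero.1 h1).resolve_right hφe
        · intro i _ hik
          rcases lt_or_gt_of_ne (fun hh => hik (Fin.ext hh) : (i : ℕ) ≠ k) with hlt | hgt
          · rw [ih i (by omega) i rfl, zero_smul]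
          · rw [← pow_add_apply, he' _ (by omega), map_zero, smul_zero]
        · simp
    funext k
    exact key k k rfl
  have hsurj : Function.Surjective (test ∘ₗ chain) := LinearMap.injective_iff_surjective.1 hinj
  have hchainM : ∀ c, chain c ∈ M := fun c => by
    rw [chain_apply]
    exact M.sum_mem fun k _ => M.smul_mem _ (pow_mem h.map_left _ heM)
  have hTchain : ∀ c, T (chain c) ∈ LinearMap.range chain := fun c => by
    rw [chain_apply, map_sum]
    refine Submodule.sum_mem _ fun k _ => ?_
    rw [map_smul, ← pow_succ_apply]
    refine Submodule.smul_mem _ _ ?_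
    by_cases hk : (k : ℕ) + 1 < p + 1
    · refine ⟨Pi.single ⟨k + 1, hk⟩ 1, ?_⟩
      rw [chain_apply, Finset.sum_eq_single ⟨k + 1, hk⟩]
      · simp
      · intro i _ hi; simp [Pi.single_eq_of_ne hi]
      · simp
    · rw [he' _ (by omega)]; exact zero_mem _
  have htestE : ∀ x ∈ E, test x = 0 := fun x hx => by
    funext j
    exact hφE _ (pow_mem h.map_right _ hx)
  have hclosed : IsClosed (LinearMap.ker test : Set X) := by
    have : Continuous test := continuous_pi fun j => (φ.comp (T ^ (j : ℕ))).continuous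
    exact isClosed_singleton.preimage this
  -- As `test ∘ₗ chain` is bijective, M is the direct sum of the span of the chain and M ∩ ker
  -- `test`. The kernel is invariant because T shifts the coordinates of `test` by one, and the
  -- coordinate entering at the end is φ ∘ T ^ (p + 1) = 0.
  refine ⟨M ⊓ LinearMap.ker test, E ⊔ LinearMap.range chain, ⟨?_, ?_, ?_, ?_, ?_, ?_⟩, inf_le_left,
    le_sup_left, ?_⟩
  · rintro x ⟨hx, hx'⟩
    refine ⟨h.map_left x hx, ?_⟩
    rw [SetLike.mem_coe, LinearMap.mem_ker] at hx' ⊢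
    funext j
    rw [test_apply]
    have hj : (T ^ (j : ℕ)) (T x) = (T ^ ((j : ℕ) + 1)) x := by rw [pow_succ]; rfl
    rw [hj]
    by_cases hk : (j : ℕ) + 1 < p + 1
    · exact congrFun hx' ⟨j + 1, hk⟩
    · exact hφ' _ (by omega) _
  · intro x hx
    obtain ⟨y, hy, _, ⟨c, rfl⟩, rfl⟩ := Submodule.mem_sup.1 hx
    rw [map_add]
    exact Submodule.add_mem_sup (h.map_right y hy) (hTchain c)
  · exact h.isClosed_left.inter hclosed
  · exact Submodule.isClosed_sup_finiteDimensional _ _ h.isClosed_right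
  · constructor
    · rw [Submodule.disjoint_def]
      rintro x ⟨hxM, hxt⟩ hx
      obtain ⟨y, hy, _, ⟨c, rfl⟩, rfl⟩ := Submodule.mem_sup.1 hx
      have hy0 : y = 0 := (Submodule.disjoint_def.1 h.isCompl.disjoint) y
        (by simpa using M.sub_mem hxM (hchainM c)) hy
      subst hy0
      rw [zero_add, SetLike.mem_coe, LinearMap.mem_ker] at hxt
      have : c = 0 := hinj (by rw [LinearMap.comp_apply, hxt, map_zero])
      simp [this]
    · rw [codisjoint_iff, eq_top_iff]
      rintro x -
      obtain ⟨m, hm, y, hy, rfl⟩ := Submodule.mem_sup.1 (h.isCompl.sup_eq_top ▸ Submodule.mem_top :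
        x ∈ M ⊔ E)
      obtain ⟨c, hc⟩ := hsurj (test m)
      rw [Submodule.mem_sup]
      refine ⟨m - chain c, ⟨M.sub_mem hm (hchainM c), ?_⟩, y + chain c,
        Submodule.add_mem_sup hy ⟨c, rfl⟩, by abel⟩
      rw [SetLike.mem_coe, LinearMap.mem_ker, map_sub, ← hc, LinearMap.comp_apply, sub_self]
  · refine sup_le h.right_le ?_
    rintro _ ⟨c, rfl⟩
    refine mem_quasinilpotentPart_of_pow_eq_zero (p := p + 1) ?_
    rw [chain_apply, map_sum]
    refine Finset.sum_eq_zero fun k _ => ?_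
    rw [map_smul, ← pow_add_apply, he' _ (by omega), smul_zero]
  · refine Submodule.mem_sup_right ⟨Pi.single 0 1, ?_⟩
    rw [chain_apply, Finset.sum_eq_single 0]
    · simp
    · intro i _ hi; simp [Pi.single_eq_of_ne hi]
    · simp

/-- An operator with closed range and finite-dimensional kernel on `M` maps closed subspaces of `M`
to closed subspaces. -/
theorem isClosed_map_of_le [CompleteSpace X] {T : X →L[ℂ] X} {M Z : Submodule ℂ X}
    (hM : IsClosed (M : Set X)) (hTM : IsClosed (M.map T.toLinearMap : Set X))
    (hfd : FiniteDimensional ℂ (T.ker ⊓ M : Submodule ℂ X))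
    (hZ : IsClosed (Z : Set X)) (hZM : Z ≤ M) : IsClosed (Z.map T.toLinearMap : Set X) := by
  have := hM.completeSpace_coe
  have := hTM.completeSpace_coe
  let A : M →L[ℂ] ↥(M.map T.toLinearMap) :=
    T.restrict fun x hx => Submodule.mem_map_of_mem hx
  have hA : Function.Surjective A := by
    rintro ⟨_, x, hx, rfl⟩
    exact ⟨⟨x, hx⟩, rfl⟩
  -- The preimage of T Z in M is Z + (N(T) ∩ M), a finite-dimensional enlargement of a closed
  -- subspace. By the open mapping theorem `A` is a quotient map, so closedness descends to T Z.
  have hs : IsClosed ((Z ⊔ (T.ker ⊓ M) : Submodule ℂ X) : Set X) :=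
    Submodule.isClosed_sup_finiteDimensional _ _ hZ
  have h1 : IsClosed (A ⁻¹' (((↑) : ↥(M.map T.toLinearMap) → X) ⁻¹'
      (Z.map T.toLinearMap : Set X))) := by
    convert hs.preimage (continuous_subtype_val (p := fun x => x ∈ M)) using 1
    ext ⟨x, hx⟩
    simp only [Set.mem_preimage, SetLike.mem_coe]
    constructor
    · rintro ⟨z, hz, hzx⟩
      have hzx' : T z = T x := hzx
      refine Submodule.mem_sup.2 ⟨z, hz, x - z, ⟨?_, M.sub_mem hx (hZM hz)⟩, by abel⟩
      simp [hzx']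
    · intro hx'
      obtain ⟨z, hz, k, ⟨hk, -⟩, hzk⟩ := Submodule.mem_sup.1 hx'
      refine ⟨z, hz, ?_⟩
      have hk' : T k = 0 := hk
      change T z = T x
      rw [← hzk, map_add, hk', add_zero]
  have h2 := (A.isQuotientMap hA).isClosed_preimage.1 h1
  have h3 := hTM.isClosedEmbedding_subtypeVal.isClosedMap _ h2
  convert h3 using 1
  exact ((Subtype.image_preimage_coe _ _).trans
    (Set.inter_eq_right.2 (Submodule.map_mono hZM))).symm

end PseudoBFredholm

/-! ### Finite ascent and reduction to an injective part -/

namespace PseudoBFredholm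

variable {X : Type*} [NormedAddCommGroup X] [NormedSpace ℂ X]

theorem map_pow_succ_eq (T : X →L[ℂ] X) (M : Submodule ℂ X) (n : ℕ) :
    M.map (T ^ (n + 1)).toLinearMap = (M.map (T ^ n).toLinearMap).map T.toLinearMap := by
  rw [← Submodule.map_comp, pow_succ']
  rfl

theorem map_pow_le {T : X →L[ℂ] X} {M : Submodule ℂ X} (h : ∀ x ∈ M, T x ∈ M) (n : ℕ) :
    M.map (T ^ n).toLinearMap ≤ M := by
  rintro _ ⟨x, hx, rfl⟩
  exact pow_mem h n hx

theorem map_pow_antitone {T : X →L[ℂ] X} {M : Submodule ℂ X} (h : ∀ x ∈ M, T x ∈ M) :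
    Antitone fun n : ℕ => M.map (T ^ n).toLinearMap := by
  refine antitone_nat_of_succ_le fun n => ?_
  rintro _ ⟨x, hx, rfl⟩
  refine ⟨T x, h x hx, ?_⟩
  change (T ^ n) (T x) = (T ^ (n + 1)) x
  rw [pow_succ]; rfl

/-- A decreasing sequence of subspaces of a finite-dimensional space is eventually constant. -/
theorem exists_forall_eq_of_antitone {K : Submodule ℂ X} [FiniteDimensional ℂ K]
    {V : ℕ → Submodule ℂ X} (hV : Antitone V) (hK : ∀ n, V n ≤ K) :
    ∃ p, ∀ n, p ≤ n → V n = V p := by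
  have hfd : ∀ n, FiniteDimensional ℂ (V n) := fun n => Submodule.finiteDimensional_of_le (hK n)
  refine ⟨Function.argmin fun n => Module.finrank ℂ (V n), fun n hn => ?_⟩
  have := hfd (Function.argmin fun n => Module.finrank ℂ (V n))
  exact Submodule.eq_of_le_of_finrank_le (hV hn)
    (Function.argmin_le (fun n => Module.finrank ℂ (V n)) n)

section

variable [CompleteSpace X] {T : X →L[ℂ] X} {M : Submodule ℂ X}

theorem isClosed_map_pow (h : ∀ x ∈ M, T x ∈ M) (hM : IsClosed (M : Set X))
    (hTM : IsClosed (M.map T.toLinearMap : Set X))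
    (hfd : FiniteDimensional ℂ (T.ker ⊓ M : Submodule ℂ X)) (n : ℕ) :
    IsClosed (M.map (T ^ n).toLinearMap : Set X) := by
  induction n with
  | zero => convert hM using 2; ext x; simp
  | succ n ih =>
    rw [map_pow_succ_eq]
    exact isClosed_map_of_le hM hTM hfd ih (map_pow_le h n)

/-- Under the SVEP at `0`, an operator with closed range and finite-dimensional kernel has finite
ascent. -/
theorem exists_ascent (hT : HasSVEPAt T 0) (h : ∀ x ∈ M, T x ∈ M) (hM : IsClosed (M : Set X))
    (hTM : IsClosed (M.map T.toLinearMap : Set X))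
    (hfd : FiniteDimensional ℂ (T.ker ⊓ M : Submodule ℂ X)) :
    ∃ p, ∀ x ∈ M, (T ^ (p + 1)) x = 0 → (T ^ p) x = 0 := by
  let W : ℕ → Submodule ℂ X := fun n => M.map (T ^ n).toLinearMap
  have hW : Antitone W := map_pow_antitone h
  -- This p, where the subspaces N(T) ∩ TⁿM become constant, bounds the ascent. The intersection of
  -- all TⁿM will be mapped onto itself by T, hence lie in K(T).
  obtain ⟨p, hp⟩ := exists_forall_eq_of_antitone (K := T.ker ⊓ M) (V := fun n => T.ker ⊓ W n)
    (fun m n hmn => inf_le_inf_left _ (hW hmn)) (fun n => inf_le_inf_left _ (map_pow_le h n))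
  have hmap : ∀ x n, x ∈ W n → T x ∈ W (n + 1) := fun x n hx => by
    change T x ∈ M.map _
    rw [map_pow_succ_eq]
    exact Submodule.mem_map_of_mem hx
  have hZc : IsClosed ((⨅ n, W n : Submodule ℂ X) : Set X) := by
    rw [Submodule.coe_iInf]
    exact isClosed_iInter fun n => isClosed_map_pow h hM hTM hfd n
  have hcore : (⨅ n, W n) ≤ analyticCore T := by
    refine le_analyticCore hZc (fun x hx => ?_) fun y hy => ?_
    · rw [Submodule.mem_iInf] at hx ⊢
      exact fun n => hW n.le_succ (hmap x n (hx n))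
    · rw [Submodule.mem_iInf] at hy
      have hpre : ∀ n, ∃ x ∈ W n, T x = y := fun n => by
        have := hy (n + 1)
        change y ∈ M.map _ at this
        rw [map_pow_succ_eq] at this
        exact this
      -- A preimage of y in TᵖM lies in every TⁿM: it differs from a preimage in TⁿM by an element
      -- of N(T) ∩ TᵖM = N(T) ∩ TⁿM.
      obtain ⟨x, hx, hxy⟩ := hpre p
      refine ⟨x, Submodule.mem_iInf _ |>.2 fun n => ?_, hxy⟩
      rcases le_total n p with hn | hn
      · exact hW hn hx
      · obtain ⟨x', hx', hxy'⟩ := hpre n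
        have h1 : x - x' ∈ T.ker ⊓ W p :=
          ⟨by simp [hxy, hxy'], (W p).sub_mem hx (hW hn hx')⟩
        rw [← hp n hn] at h1
        simpa using (W n).add_mem h1.2 hx'
  refine ⟨p, fun x hx hx0 => ?_⟩
  have hk : T ((T ^ p) x) = 0 := by rwa [← pow_succ_apply]
  refine eq_zero_of_mem_ker_of_mem_analyticCore hT hk (hcore ?_)
  refine Submodule.mem_iInf _ |>.2 fun n => ?_
  have hxp : (T ^ p) x ∈ T.ker ⊓ W p := ⟨hk, x, hx, rfl⟩
  rcases le_total n p with hn | hn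
  · exact hW hn hxp.2
  · rw [← hp n hn] at hxp
    exact hxp.2

end

/-- The continuous projection onto `M` along `E`. -/
theorem IsReduction.exists_projection [CompleteSpace X] {T : X →L[ℂ] X} {M E : Submodule ℂ X}
    (h : IsReduction T M E) :
    ∃ P : X →L[ℂ] X, (∀ x, P x ∈ M) ∧ (∀ x ∈ M, P x = x) ∧ (∀ x ∈ E, P x = 0) ∧
      (∀ x, x - P x ∈ E) ∧ ∀ x, P (T x) = T (P x) := by
  have ht : Submodule.IsTopCompl M E :=
    Submodule.isTopCompl_iff_isCompl_isClosed.2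
      ⟨h.isCompl, h.isClosed_left, h.isClosed_right⟩
  have h1 : ∀ x, M.projectionL E ht x ∈ M := Submodule.projectionL_apply_mem ht
  have h2 : ∀ x ∈ M, M.projectionL E ht x = x := fun x hx =>
    Submodule.projectionL_apply_left ht ⟨x, hx⟩
  have h3 : ∀ x ∈ E, M.projectionL E ht x = 0 := fun x hx =>
    (Submodule.projectionL_apply_eq_zero_iff ht).2 hx
  have h4 : ∀ x, x - M.projectionL E ht x ∈ E := fun x => by
    rw [← Submodule.projectionL_apply_eq_zero_iff ht, map_sub, h2 _ (h1 x), sub_self]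
  refine ⟨M.projectionL E ht, h1, h2, h3, h4, fun x => ?_⟩
  have hx : T x = T (M.projectionL E ht x) + T (x - M.projectionL E ht x) := by
    rw [← map_add]; congr 1; abel
  rw [hx, map_add, h2 _ (h.map_left _ (h1 x)), h3 _ (h.map_right _ (h4 x)), add_zero]

theorem apply_pow_comm {T P : X →L[ℂ] X} (h : ∀ x, P (T x) = T (P x)) (n : ℕ) (x : X) :
    P ((T ^ n) x) = (T ^ n) (P x) := by
  induction n with
  | zero => simp
  | succ n ih => rw [pow_succ_apply, pow_succ_apply, h, ih]

/-- This passes closedness from T M to T M'. If T(m + y) lies in M' with m ∈ M' and y ∈ E', then Ty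
∈ M' ∩ E' = 0, so m has the same image. -/
theorem IsReduction.map_eq_inf_of_le {T : X →L[ℂ] X} {M M' E' : Submodule ℂ X}
    (h' : IsReduction T M' E') (hM : M' ≤ M) :
    M'.map T.toLinearMap = M.map T.toLinearMap ⊓ M' := by
  apply le_antisymm
  · exact le_inf (Submodule.map_mono hM) (Submodule.map_le_iff_le_comap.2 h'.map_left)
  · rintro _ ⟨⟨x, hx, rfl⟩, hx'⟩
    obtain ⟨m, hm, y, hy, rfl⟩ := Submodule.mem_sup.1
      (h'.isCompl.sup_eq_top ▸ Submodule.mem_top : x ∈ M' ⊔ E')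
    have h1 : T (m + y) ∈ M' := hx'
    rw [map_add] at h1
    have h2 : T y ∈ M' := by simpa using M'.sub_mem h1 (h'.map_left m hm)
    have h3 : T y = 0 := Submodule.disjoint_def.1 h'.isCompl.disjoint _ h2 (h'.map_right y hy)
    exact ⟨m, hm, by change T m = T (m + y); rw [map_add, h3, add_zero]⟩

/-- If `T` has the SVEP at `0` and its part on `M` is upper semi-Fredholm, then `M` can be shrunk
to a summand on which `T` is injective with closed range. -/
theorem IsReduction.exists_injective [CompleteSpace X] {T : X →L[ℂ] X} (hT : HasSVEPAt T 0)
    {M E : Submodule ℂ X} (h : IsReduction T M E) (hTM : IsClosed (M.map T.toLinearMap : Set X))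
    (hfd : FiniteDimensional ℂ (T.ker ⊓ M : Submodule ℂ X)) :
    ∃ M' E' : Submodule ℂ X, IsReduction T M' E' ∧ (∀ x ∈ M', T x = 0 → x = 0) ∧
      IsClosed (M'.map T.toLinearMap : Set X) := by
  induction hn : Module.finrank ℂ (T.ker ⊓ M : Submodule ℂ X) using Nat.strong_induction_on
    generalizing M E with
  | _ n ih =>
  by_cases hinj : ∀ x ∈ M, T x = 0 → x = 0
  · exact ⟨M, E, h, hinj, hTM⟩
  obtain ⟨p, hp, hpmin⟩ : ∃ p, (∀ x ∈ M, (T ^ (p + 1)) x = 0 → (T ^ p) x = 0) ∧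
      ∀ q < p, ¬ ∀ x ∈ M, (T ^ (q + 1)) x = 0 → (T ^ q) x = 0 := by
    classical
    have := exists_ascent hT h.map_left h.isClosed_left hTM hfd
    exact ⟨Nat.find this, Nat.find_spec this, fun q hq => Nat.find_min this hq⟩
  obtain ⟨q, rfl⟩ : ∃ q, p = q + 1 := by
    refine Nat.exists_eq_succ_of_ne_zero fun h0 => hinj fun x hx hx0 => ?_
    subst h0
    simpa using hp x hx (by simpa using hx0)
  have := hpmin q q.lt_succ_self
  push Not at this
  obtain ⟨e, heM, he, hqe⟩ := this
  -- The chain through e has maximal length: if T ^ q e = T ^ (q + 1) x, then T ^ (q + 2) x = 0, and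
  -- the ascent q + 1 gives T ^ q e = 0.
  have hnot : (T ^ q) e ∉ M.map (T ^ (q + 1)).toLinearMap := by
    rintro ⟨x, hx, hxe⟩
    have hxe' : (T ^ (q + 1)) x = (T ^ q) e := hxe
    apply hqe
    rw [← hxe']
    refine hp x hx ?_
    rw [pow_succ_apply, hxe', ← pow_succ_apply, he]
  obtain ⟨ψ, hψ, hψe⟩ := exists_dual_ne_zero_of_notMem
    (isClosed_map_pow h.map_left h.isClosed_left hTM hfd (q + 1)) hnot
  obtain ⟨P, hPM, hPid, hPE, -, hPT⟩ := h.exists_projection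
  obtain ⟨M', E', h', hM, hE, heE⟩ := h.exists_splitting (φ := ψ.comp P) heM he
    (fun x hx => by simp [hPE x hx])
    (fun x => by
      change ψ (P _) = 0
      rw [apply_pow_comm hPT]
      exact hψ _ ⟨P x, hPM x, rfl⟩)
    (by
      change ψ (P _) ≠ 0
      rwa [hPid _ (pow_mem h.map_left q heM)])
  have hle : T.ker ⊓ M' ≤ T.ker ⊓ M := inf_le_inf_left _ hM
  refine ih _ ?_ h' ?_ (Submodule.finiteDimensional_of_le hle) rfl
  · rw [← hn]
    -- The end T ^ q e of the chain is a nonzero kernel vector in M that has moved to E', so it has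
    -- left the kernel on M'.
    refine Submodule.finrank_lt_finrank_of_lt (lt_of_le_of_ne hle fun heq => hqe ?_)
    have hmem : (T ^ q) e ∈ T.ker ⊓ M :=
      ⟨by change T _ = 0; rw [← pow_succ_apply, he], pow_mem h.map_left q heM⟩
    rw [← heq] at hmem
    exact Submodule.disjoint_def.1 h'.isCompl.disjoint _ hmem.2 (pow_mem h'.map_right q heE)
  · rw [h'.map_eq_inf_of_le hM]
    exact hTM.inter h'.isClosed_left

end PseudoBFredholm

/-! ### Ranges of finite codimension and annihilators -/

namespace PseudoBFredholm

variable {X : Type*} [NormedAddCommGroup X] [NormedSpace ℂ X]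

theorem finiteDimensional_quotient_of_sup_eq_top {R F : Submodule ℂ X} [FiniteDimensional ℂ F]
    (h : R ⊔ F = ⊤) : FiniteDimensional ℂ (X ⧸ R) := by
  refine Module.Finite.of_surjective (R.mkQ ∘ₗ F.subtype) fun y => ?_
  obtain ⟨x, rfl⟩ := R.mkQ_surjective y
  obtain ⟨r, hr, f, hf, rfl⟩ := Submodule.mem_sup.1 (h ▸ Submodule.mem_top : x ∈ R ⊔ F)
  refine ⟨⟨f, hf⟩, ?_⟩
  have : R.mkQ r = 0 := (Submodule.Quotient.mk_eq_zero R).2 hr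
  simp only [LinearMap.comp_apply, Submodule.subtype_apply, map_add, this, zero_add]

/-- An operator between Banach spaces with range of finite codimension has closed range. -/
theorem isClosed_range_of_finiteDimensional_quotient [CompleteSpace X] {Y : Type*}
    [NormedAddCommGroup Y] [NormedSpace ℂ Y] [CompleteSpace Y] (A : Y →L[ℂ] X)
    (h : FiniteDimensional ℂ (X ⧸ A.range)) : IsClosed (A.range : Set X) := by
  obtain ⟨F, hF⟩ := A.range.exists_isCompl
  have : FiniteDimensional ℂ F := .of_fg <| Submodule.CoFG.fg_of_isCompl hF h
  -- `B` is onto, hence a quotient map, and the preimage of the range of A is the closed set where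
  -- the F-component vanishes.
  let B : Y × F →L[ℂ] X := A.coprod F.subtypeL
  have hB : Function.Surjective B := by
    intro x
    obtain ⟨_, ⟨y, rfl⟩, f, hf, rfl⟩ := Submodule.mem_sup.1
      (hF.sup_eq_top ▸ Submodule.mem_top : x ∈ A.range ⊔ F)
    exact ⟨(y, ⟨f, hf⟩), by simp [B]⟩
  rw [← (B.isQuotientMap hB).isClosed_preimage]
  suffices hpre : B ⁻¹' (A.range : Set X) = Prod.snd ⁻¹' {(0 : F)} by
    rw [hpre]
    exact isClosed_singleton.preimage continuous_snd
  ext ⟨y, f⟩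
  have hBy : B (y, f) = A y + f := by simp [B]
  simp only [Set.mem_preimage, SetLike.mem_coe, Set.mem_singleton_iff, hBy]
  constructor
  · intro hy
    have h1 : (f : X) ∈ A.range := by simpa using A.range.sub_mem hy ⟨y, rfl⟩
    exact Subtype.ext (Submodule.disjoint_def.1 hF.disjoint _ h1 f.2)
  · rintro rfl
    exact ⟨y, by simp⟩

section

variable {T : X →L[ℂ] X} {M E : Submodule ℂ X}

theorem IsReduction.mem_sup (h : IsReduction T M E) (x : X) : x ∈ M ⊔ E :=
  h.isCompl.sup_eq_top ▸ Submodule.mem_top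

/-- The kernel may be infinite-dimensional here, so closedness comes from codimension: TⁿM ⊕ E has
finite codimension and is the range of TⁿP + (1 - P), where P projects onto M along E. Intersecting
with M leaves TⁿM. -/
theorem IsReduction.isClosed_map_pow_of_finiteDimensional [CompleteSpace X] (h : IsReduction T M E)
    (hfd : FiniteDimensional ℂ (X ⧸ (M.map T.toLinearMap ⊔ E))) (n : ℕ) :
    IsClosed (M.map (T ^ n).toLinearMap : Set X) := by
  obtain ⟨P, hPM, hPid, hPE, hPE', hPT⟩ := h.exists_projection
  obtain ⟨F, hF⟩ := (M.map T.toLinearMap ⊔ E).exists_isCompl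
  have : FiniteDimensional ℂ F := .of_fg <| Submodule.CoFG.fg_of_isCompl hF hfd
  have key : ∀ n : ℕ, ∃ G : Submodule ℂ X, FiniteDimensional ℂ G ∧
      (M.map (T ^ n).toLinearMap ⊔ E) ⊔ G = ⊤ := by
    intro n
    induction n with
    | zero =>
      refine ⟨⊥, inferInstance, ?_⟩
      have : M.map (T ^ 0).toLinearMap = M := by ext x; simp
      rw [this, h.isCompl.sup_eq_top, top_sup_eq]
    | succ n ih =>
      obtain ⟨G, hG, hGtop⟩ := ih
      -- Since M = TM + PF, passing from TⁿM to Tⁿ⁺¹M loses at most the finite-dimensional space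
      -- TⁿPF.
      refine ⟨(F.map P.toLinearMap).map (T ^ n).toLinearMap ⊔ G, inferInstance, ?_⟩
      rw [eq_top_iff, ← hGtop]
      refine sup_le (sup_le ?_ (le_sup_right.trans le_sup_left)) (le_sup_right.trans le_sup_right)
      rintro _ ⟨x, hx, rfl⟩
      obtain ⟨y, hy, f, hf, hyf⟩ := Submodule.mem_sup.1
        (hF.sup_eq_top ▸ Submodule.mem_top : x ∈ (M.map T.toLinearMap ⊔ E) ⊔ F)
      obtain ⟨_, ⟨m, hm, rfl⟩, e, he, rfl⟩ := Submodule.mem_sup.1 hy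
      have hxe : x = T m + P f := by
        have h1 := congrArg P hyf
        rw [hPid x hx, map_add, map_add, hPE e he, add_zero] at h1
        rw [← h1]
        congr 1
        exact hPid (T m) (h.map_left m hm)
      have hx' : (T ^ n).toLinearMap x = (T ^ (n + 1)) m + (T ^ n) (P f) := by
        change (T ^ n) x = _
        rw [hxe, map_add, pow_succ]; rfl
      rw [hx']
      exact add_mem (Submodule.mem_sup_left (Submodule.mem_sup_left ⟨m, hm, rfl⟩))
        (Submodule.mem_sup_right (Submodule.mem_sup_left ⟨P f, ⟨f, hf, rfl⟩, rfl⟩))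
  obtain ⟨G, hG, hGtop⟩ := key n
  have hq := finiteDimensional_quotient_of_sup_eq_top hGtop
  let B : X →L[ℂ] X := T ^ n * P + (1 - P)
  have hBx : ∀ x, B x = (T ^ n) (P x) + (x - P x) := fun x => rfl
  have hB : B.range = M.map (T ^ n).toLinearMap ⊔ E := by
    apply le_antisymm
    · rintro _ ⟨x, rfl⟩
      exact Submodule.add_mem_sup ⟨P x, hPM x, rfl⟩ (hPE' x)
    · refine sup_le ?_ fun x hx => ⟨x, ?_⟩
      · rintro _ ⟨x, hx, rfl⟩
        refine ⟨x, ?_⟩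
        change B x = (T ^ n) x
        rw [hBx, hPid x hx, sub_self, add_zero]
      · change B x = x
        rw [hBx, hPE x hx, map_zero, zero_add, sub_zero]
  have hcl : IsClosed ((M.map (T ^ n).toLinearMap ⊔ E : Submodule ℂ X) : Set X) := by
    rw [← hB]
    exact isClosed_range_of_finiteDimensional_quotient B (by rwa [hB])
  have heq : M.map (T ^ n).toLinearMap = (M.map (T ^ n).toLinearMap ⊔ E) ⊓ M := by
    rw [sup_inf_assoc_of_le E (map_pow_le h.map_left n), inf_comm E M, h.isCompl.inf_eq_bot,
      sup_bot_eq]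
  rw [heq]
  exact hcl.inter h.isClosed_left

/-- The annihilator of `E` in the topological dual. -/
def annihilator (E : Submodule ℂ X) : Submodule ℂ (StrongDual ℂ X) where
  carrier := {φ | ∀ x ∈ E, φ x = 0}
  zero_mem' := fun _ _ => rfl
  add_mem' := fun hφ hψ x hx => by simp [hφ x hx, hψ x hx]
  smul_mem' := fun c φ hφ x hx => by simp [hφ x hx]

theorem mem_annihilator {φ : StrongDual ℂ X} : φ ∈ annihilator E ↔ ∀ x ∈ E, φ x = 0 := Iff.rfl

theorem isClosed_annihilator (E : Submodule ℂ X) :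
    IsClosed (annihilator E : Set (StrongDual ℂ X)) := by
  have : (annihilator E : Set (StrongDual ℂ X)) = ⋂ x ∈ E, {φ | φ x = 0} := by
    ext φ; simp [mem_annihilator]
  rw [this]
  exact isClosed_biInter fun x _ => isClosed_eq (by fun_prop) continuous_const

theorem adjointOp_apply (T : X →L[ℂ] X) (φ : StrongDual ℂ X) (x : X) :
    adjointOp T φ x = φ (T x) := rfl

set_option synthInstance.maxHeartbeats 200000 in
theorem adjointOp_pow_apply (T : X →L[ℂ] X) (n : ℕ) (φ : StrongDual ℂ X) (x : X) :
    (adjointOp T ^ n) φ x = φ ((T ^ n) x) := by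
  induction n generalizing x with
  | zero => simp
  | succ n ih =>
    rw [pow_succ_apply, adjointOp_apply, ih, pow_succ]
    rfl

theorem adjointOp_mem_annihilator (h : ∀ x ∈ E, T x ∈ E) :
    ∀ φ ∈ annihilator E, adjointOp T φ ∈ annihilator E :=
  fun _ hφ x hx => hφ _ (h x hx)

/-- The range of the adjoint is the annihilator of the kernel, if the range is closed. -/
theorem IsReduction.map_adjointOp_annihilator [CompleteSpace X] (h : IsReduction T M E)
    (hTM : IsClosed (M.map T.toLinearMap : Set X)) :
    (annihilator E).map (adjointOp T).toLinearMap = annihilator (E ⊔ (T.ker ⊓ M)) := by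
  obtain ⟨P, hPM, hPid, hPE, hPE', hPT⟩ := h.exists_projection
  apply le_antisymm
  · rintro _ ⟨φ, hφ, rfl⟩ x hx
    obtain ⟨e, he, k, ⟨hk, -⟩, rfl⟩ := Submodule.mem_sup.1 hx
    change φ (T (e + k)) = 0
    have hk' : T k = 0 := hk
    rw [map_add, hk', add_zero]
    exact hφ _ (h.map_right e he)
  · intro ψ hψ
    have := h.isClosed_left.completeSpace_coe
    have := hTM.completeSpace_coe
    let A : M →L[ℂ] ↥(M.map T.toLinearMap) := T.restrict fun x hx => Submodule.mem_map_of_mem hx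
    have hA : Function.Surjective A := by
      rintro ⟨_, x, hx, rfl⟩
      exact ⟨⟨x, hx⟩, rfl⟩
    obtain ⟨C, hC, hpre⟩ := A.exists_preimage_norm_le hA
    choose g hg hgb using hpre
    have hwd : ∀ x y : M, A x = A y → ψ x = ψ y := fun x y hxy => by
      have hxy' : T x = T y := congrArg Subtype.val hxy
      have : ψ ((x : X) - y) = 0 := hψ _ (Submodule.mem_sup_right
        ⟨by simp [hxy'], M.sub_mem x.2 y.2⟩)
      rwa [map_sub, sub_eq_zero] at this
    -- On T M the solution must be Tx ↦ ψ x. It is well defined because ψ kills N(T) ∩ M, and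
    -- bounded because the preimages `g` are norm-controlled. Hahn–Banach extends it to X, and
    -- composing with P makes it vanish on E.
    let χ₀ : StrongDual ℂ ↥(M.map T.toLinearMap) := LinearMap.mkContinuous
      { toFun := fun r => ψ (g r)
        map_add' := fun r s => by
          rw [← map_add]
          exact hwd _ (g r + g s) (by rw [map_add, hg, hg, hg])
        map_smul' := fun c r => by
          rw [RingHom.id_apply, ← map_smul]
          exact hwd _ (c • g r) (by rw [map_smul, hg, hg]) } (‖ψ‖ * C) fun r => by
      calc ‖ψ (g r)‖ ≤ ‖ψ‖ * ‖(g r : X)‖ := ψ.le_opNorm _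
        _ ≤ ‖ψ‖ * (C * ‖r‖) := by gcongr; exact hgb r
        _ = _ := by ring
    obtain ⟨χ, hχ, -⟩ := exists_extension_norm_eq (M.map T.toLinearMap) χ₀
    refine ⟨χ.comp P, fun x hx => by simp [hPE x hx], ?_⟩
    ext x
    change χ (P (T x)) = ψ x
    have h1 : χ (P (T x)) = ψ (g (A ⟨P x, hPM x⟩)) := by
      rw [hPT]
      exact hχ (A ⟨P x, hPM x⟩)
    have h2 : ψ (x - P x) = 0 := hψ _ (Submodule.mem_sup_left (hPE' x))
    rw [h1, hwd _ ⟨P x, hPM x⟩ (hg _), eq_comm, ← sub_eq_zero, ← map_sub, h2]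

/-- These functionals vanish on T M + E, so they embed into the dual of a finite-dimensional
quotient. -/
theorem finiteDimensional_ker_adjointOp
    (hfd : FiniteDimensional ℂ (X ⧸ (M.map T.toLinearMap ⊔ E))) :
    FiniteDimensional ℂ ((adjointOp T).ker ⊓ annihilator E : Submodule ℂ (StrongDual ℂ X)) := by
  have hker : ∀ φ : ((adjointOp T).ker ⊓ annihilator E : Submodule ℂ (StrongDual ℂ X)),
      M.map T.toLinearMap ⊔ E ≤ LinearMap.ker (φ : StrongDual ℂ X).toLinearMap := by
    rintro ⟨φ, hφ, hφE⟩
    refine sup_le ?_ fun x hx => hφE x hx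
    rintro _ ⟨x, -, rfl⟩
    exact congrArg (fun χ : StrongDual ℂ X => χ x) (show adjointOp T φ = 0 from hφ)
  let L : ((adjointOp T).ker ⊓ annihilator E : Submodule ℂ (StrongDual ℂ X)) →ₗ[ℂ]
      Module.Dual ℂ (X ⧸ (M.map T.toLinearMap ⊔ E)) :=
    { toFun := fun φ => Submodule.liftQ _ (φ : StrongDual ℂ X).toLinearMap (hker φ)
      map_add' := fun φ ψ => by ext x; simp
      map_smul' := fun c φ => by ext x; simp }
  refine FiniteDimensional.of_injective L fun φ ψ hφψ => ?_
  ext x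
  have := congrArg (fun l => l (Submodule.mkQ _ x)) hφψ
  simpa [L] using this

end

end PseudoBFredholm

/-! ### SVEP of the adjoint and reduction to a surjective part -/

namespace PseudoBFredholm

variable {X : Type*} [NormedAddCommGroup X] [NormedSpace ℂ X] [CompleteSpace X]
  {T : X →L[ℂ] X} {M E : Submodule ℂ X}

/-- If `T M` is closed and different from `M`, then the adjoint has a kernel on the annihilator
of `E`. -/
theorem IsReduction.exists_mem_ker_adjointOp (h : IsReduction T M E)
    (hTM : IsClosed (M.map T.toLinearMap : Set X)) (hs : ¬ ∀ y ∈ M, ∃ x ∈ M, T x = y) :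
    ∃ φ ∈ annihilator E, adjointOp T φ = 0 ∧ φ ≠ 0 := by
  obtain ⟨P, hPM, hPid, hPE, hPE', hPT⟩ := h.exists_projection
  push Not at hs
  obtain ⟨y, hy, hyT⟩ := hs
  obtain ⟨ψ, hψ, hψy⟩ := exists_dual_ne_zero_of_notMem hTM (x := y)
    (by rintro ⟨x, hx, hxy⟩; exact hyT x hx hxy)
  refine ⟨ψ.comp P, fun x hx => by simp [hPE x hx], ?_, fun h0 => hψy ?_⟩
  · ext x
    change ψ (P (T x)) = 0
    rw [hPT]
    exact hψ _ ⟨P x, hPM x, rfl⟩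
  · have h1 : (ψ.comp P) y = 0 := by rw [h0]; rfl
    rwa [ContinuousLinearMap.comp_apply, hPid y hy] at h1

/-- If `T*` has the SVEP at `0`, and `T` is injective with closed range on `M`, then `T` maps `M`
onto `M`. -/
theorem IsReduction.surjective_of_injective (hT : HasSVEPAt (adjointOp T) 0)
    (h : IsReduction T M E) (hTM : IsClosed (M.map T.toLinearMap : Set X))
    (hinj : ∀ x ∈ M, T x = 0 → x = 0) : ∀ y ∈ M, ∃ x ∈ M, T x = y := by
  by_contra hs
  obtain ⟨φ, hφE, hφ, hφ0⟩ := h.exists_mem_ker_adjointOp hTM hs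
  -- With T injective on M, the adjoint maps the annihilator of E onto itself. So this annihilator
  -- lies in K(T*), which meets N(T*) trivially by the SVEP.
  refine hφ0 (eq_zero_of_mem_ker_of_mem_analyticCore hT hφ
    (le_analyticCore (isClosed_annihilator E) (adjointOp_mem_annihilator h.map_right) ?_ hφE))
  intro ψ hψ
  have hbot : T.ker ⊓ M = ⊥ := by
    rw [Submodule.eq_bot_iff]
    rintro x ⟨hx, hxM⟩
    exact hinj x hxM hx
  have hmap := h.map_adjointOp_annihilator hTM
  rw [hbot, sup_bot_eq] at hmap
  rw [← hmap] at hψ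
  exact hψ

/-- If `T*` has the SVEP at `0` and the part of `T` on `M` is lower semi-Fredholm, then it has
finite descent, expressed here as finite ascent of the adjoint. -/
theorem IsReduction.exists_ascent_adjointOp (hT : HasSVEPAt (adjointOp T) 0)
    (h : IsReduction T M E) (hfd : FiniteDimensional ℂ (X ⧸ (M.map T.toLinearMap ⊔ E))) :
    ∃ p, ∀ φ ∈ annihilator E, (∀ x, φ ((T ^ (p + 1)) x) = 0) → ∀ x, φ ((T ^ p) x) = 0 := by
  have hTM : IsClosed (M.map T.toLinearMap : Set X) := by
    simpa using h.isClosed_map_pow_of_finiteDimensional hfd 1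
  obtain ⟨p, hp⟩ := exists_ascent hT (adjointOp_mem_annihilator h.map_right)
    (isClosed_annihilator E)
    (by rw [h.map_adjointOp_annihilator hTM]; exact isClosed_annihilator _)
    (finiteDimensional_ker_adjointOp hfd)
  refine ⟨p, fun φ hφ h0 x => ?_⟩
  rw [← adjointOp_pow_apply, hp φ hφ (by ext x; rw [adjointOp_pow_apply, h0]; rfl)]
  rfl

/-- Finite ascent of the adjoint gives finite descent. -/
theorem IsReduction.map_pow_eq_of_ascent (h : IsReduction T M E)
    (hfd : FiniteDimensional ℂ (X ⧸ (M.map T.toLinearMap ⊔ E))) {p : ℕ}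
    (hp : ∀ φ ∈ annihilator E, (∀ x, φ ((T ^ (p + 1)) x) = 0) → ∀ x, φ ((T ^ p) x) = 0) (k : ℕ) :
    ∀ x ∈ M, ∃ y ∈ M, (T ^ p) x = (T ^ (p + k)) y := by
  obtain ⟨P, hPM, hPid, hPE, hPE', hPT⟩ := h.exists_projection
  -- A functional killing the closed space T ^ (p + 1) M, composed with P, falls under the ascent
  -- hypothesis and so kills T ^ p M. Hahn–Banach then gives T ^ p M ⊆ T ^ (p + 1) M.
  have step : ∀ x ∈ M, ∃ y ∈ M, (T ^ p) x = (T ^ (p + 1)) y := by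
    by_contra! hs
    obtain ⟨x, hx, hxy⟩ := hs
    obtain ⟨ψ, hψ, hψx⟩ := exists_dual_ne_zero_of_notMem
      (h.isClosed_map_pow_of_finiteDimensional hfd (p + 1)) (x := (T ^ p) x)
      (by rintro ⟨y, hy, hyx⟩; exact hxy y hy hyx.symm)
    apply hψx
    have := hp (ψ.comp P) (fun x hx => by simp [hPE x hx]) (fun z => by
      change ψ (P _) = 0
      rw [apply_pow_comm hPT]
      exact hψ _ ⟨P z, hPM z, rfl⟩) x
    rwa [ContinuousLinearMap.comp_apply, hPid _ (pow_mem h.map_left p hx)] at this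
  induction k with
  | zero => exact fun x hx => ⟨x, hx, rfl⟩
  | succ k ih =>
    intro x hx
    obtain ⟨y, hy, hxy⟩ := ih x hx
    obtain ⟨z, hz, hyz⟩ := step y hy
    refine ⟨z, hz, ?_⟩
    rw [hxy, add_comm p k, pow_add_apply, hyz, ← pow_add_apply]
    congr 2
    ring

/-- If `T*` has the SVEP at `0` and the part of `T` on `M` is lower semi-Fredholm, then `M` can be
shrunk to a summand which `T` maps onto itself. -/
theorem IsReduction.exists_surjective (hT : HasSVEPAt (adjointOp T) 0)
    (h : IsReduction T M E) (hfd : FiniteDimensional ℂ (X ⧸ (M.map T.toLinearMap ⊔ E))) :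
    ∃ M' E' : Submodule ℂ X, IsReduction T M' E' ∧ ∀ y ∈ M', ∃ x ∈ M', T x = y := by
  induction hn : Module.finrank ℂ
    ((adjointOp T).ker ⊓ annihilator E : Submodule ℂ (StrongDual ℂ X))
    using Nat.strong_induction_on generalizing M E with
  | _ n ih =>
  by_cases hs : ∀ y ∈ M, ∃ x ∈ M, T x = y
  · exact ⟨M, E, h, hs⟩
  have hTM : IsClosed (M.map T.toLinearMap : Set X) := by
    simpa using h.isClosed_map_pow_of_finiteDimensional hfd 1
  obtain ⟨P, hPM, hPid, hPE, hPE', hPT⟩ := h.exists_projection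
  obtain ⟨p, hp, hpmin⟩ : ∃ p, (∀ φ ∈ annihilator E, (∀ x, φ ((T ^ (p + 1)) x) = 0) →
      ∀ x, φ ((T ^ p) x) = 0) ∧ ∀ q < p, ¬ ∀ φ ∈ annihilator E,
        (∀ x, φ ((T ^ (q + 1)) x) = 0) → ∀ x, φ ((T ^ q) x) = 0 := by
    classical
    have := h.exists_ascent_adjointOp hT hfd
    exact ⟨Nat.find this, Nat.find_spec this, fun q hq => Nat.find_min this hq⟩
  obtain ⟨q, rfl⟩ : ∃ q, p = q + 1 := by
    refine Nat.exists_eq_succ_of_ne_zero fun h0 => ?_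
    subst h0
    obtain ⟨φ, hφE, hφ, hφ0⟩ := h.exists_mem_ker_adjointOp hTM hs
    refine hφ0 (ContinuousLinearMap.ext fun x => ?_)
    simpa using hp φ hφE (fun x => by
      rw [zero_add, pow_one, ← adjointOp_apply, hφ]; rfl) x
  have := hpmin q q.lt_succ_self
  push Not at this
  obtain ⟨φ, hφE, hφ, x, hφx⟩ := this
  have hφP : ∀ y, φ (P y) = φ y := fun y => by
    have := hφE _ (hPE' y)
    rw [map_sub, sub_eq_zero] at this
    exact this.symm
  -- The extra q + 1 powers serve two ends: e = P x - T ^ (q + 1) y satisfies T ^ (q + 1) e = 0, and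
  -- φ ∘ T ^ q does not see the correction, as φ ∘ T ^ (2q + 1) = 0.
  obtain ⟨y, hy, hxy⟩ := h.map_pow_eq_of_ascent hfd hp (q + 1) (P x) (hPM x)
  set e := P x - (T ^ (q + 1)) y with he_def
  have heM : e ∈ M := M.sub_mem (hPM x) (pow_mem h.map_left _ hy)
  have he : (T ^ (q + 1)) e = 0 := by
    rw [he_def, map_sub, hxy, pow_add_apply, sub_self]
  have hφe : φ ((T ^ q) e) ≠ 0 := by
    rw [he_def, map_sub, map_sub, ← apply_pow_comm hPT, hφP, ← pow_add_apply, add_comm q,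
      pow_add_apply, hφ, sub_zero]
    exact hφx
  obtain ⟨M', E', h', hM, hE, heE⟩ := h.exists_splitting heM he hφE hφ hφe
  have hsup : M.map T.toLinearMap ⊔ E ≤ M'.map T.toLinearMap ⊔ E' := by
    refine sup_le ?_ (hE.trans le_sup_right)
    rintro _ ⟨x, -, rfl⟩
    obtain ⟨m, hm, z, hz, rfl⟩ := Submodule.mem_sup.1 (h'.mem_sup x)
    rw [map_add]
    exact Submodule.add_mem_sup ⟨m, hm, rfl⟩ (h'.map_right z hz)
  refine ih _ ?_ h' (Submodule.CoFG.of_le hsup hfd) rfl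
  have hle : (adjointOp T).ker ⊓ annihilator E' ≤ (adjointOp T).ker ⊓ annihilator E :=
    inf_le_inf_left _ fun χ hχ x hx => hχ x (hE hx)
  have := finiteDimensional_ker_adjointOp hfd
  rw [← hn]
  -- The functional φ ∘ T ^ q lies in N(T*) and kills E, but not e ∈ E', so the dimension drops.
  refine Submodule.finrank_lt_finrank_of_lt (lt_of_le_of_ne hle fun heq => hφe ?_)
  have hmem : φ.comp (T ^ q) ∈ (adjointOp T).ker ⊓ annihilator E := by
    refine ⟨?_, fun x hx => hφE _ (pow_mem h.map_right q hx)⟩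
    ext x
    change φ ((T ^ q) (T x)) = 0
    rw [← hφ x, pow_succ]
    rfl
  rw [← heq] at hmem
  exact hmem.2 e heE

end PseudoBFredholm

/-! ### Laurent coefficients of the resolvent and the Riesz decomposition -/

namespace PseudoBFredholm

section Resolvent

variable {A : Type*} [NormedRing A] [NormedAlgebra ℂ A]

theorem circleIntegral_clm_comp [CompleteSpace A] {f : ℂ → A} {s : ℝ} (hs : 0 ≤ s)
    (hf : ContinuousOn f (Metric.sphere 0 s)) (L : A →L[ℂ] A) :
    (∮ z in C(0, s), L (f z)) = L (∮ z in C(0, s), f z) := by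
  simp only [circleIntegral, ← map_smul]
  exact L.intervalIntegral_comp_comm (hf.circleIntegrable hs).out

theorem mul_resolvent {a : A} {z : ℂ} (hz : z ∈ resolventSet ℂ a) :
    a * resolvent a z = z • resolvent a z - 1 := by
  have h : (algebraMap ℂ A z - a) * resolvent a z = 1 := Ring.mul_inverse_cancel _ hz
  rw [sub_mul, Algebra.algebraMap_eq_smul_one, smul_one_mul] at h
  rw [← h]; abel

theorem resolvent_mul {a : A} {z : ℂ} (hz : z ∈ resolventSet ℂ a) :
    resolvent a z * a = z • resolvent a z - 1 := by
  have h : resolvent a z * (algebraMap ℂ A z - a) = 1 := Ring.inverse_mul_cancel _ hz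
  rw [mul_sub, Algebra.algebraMap_eq_smul_one, mul_smul_one] at h
  rw [← h]; abel

/-- The coefficients `(2πi)⁻¹ ∮ zⁿ (z - a)⁻¹ dz` of the Laurent series of the resolvent. -/
noncomputable def laurentCoeff (a : A) (s : ℝ) (n : ℤ) : A :=
  (2 * Real.pi * Complex.I : ℂ)⁻¹ • ∮ z in C(0, s), z ^ n • resolvent a z

variable [CompleteSpace A] {a : A} {r : ℝ}

theorem differentiableOn_zpow_smul_resolvent
    (hr : ∀ z : ℂ, z ≠ 0 → ‖z‖ < r → z ∈ resolventSet ℂ a) (n : ℤ) :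
    DifferentiableOn ℂ (fun z : ℂ => z ^ n • resolvent a z) {z | z ≠ 0 ∧ ‖z‖ < r} :=
  fun z hz => DifferentiableAt.differentiableWithinAt <|
    (differentiableAt_zpow.2 (Or.inl hz.1)).smul
      (spectrum.hasDerivAt_resolvent_const_left (hr z hz.1 hz.2)).differentiableAt

theorem sphere_subset {s : ℝ} (hs : 0 < s) (hsr : s < r) :
    Metric.sphere (0 : ℂ) s ⊆ {z | z ≠ 0 ∧ ‖z‖ < r} := by
  intro z hz
  rw [mem_sphere_zero_iff_norm] at hz
  exact ⟨norm_pos_iff.1 (hz ▸ hs), hz ▸ hsr⟩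

/-- By a R(z) = R(z) a = z R(z) - 1 for the resolvent R, this integral is a times the n-th
coefficient, on either side. Multiplication by a thus shifts the index, with a correction only from
the residue of z⁻¹. -/
theorem circleIntegral_zpow_smul_sub {s : ℝ} (hs : 0 < s) (hsr : s < r)
    (hr : ∀ z : ℂ, z ≠ 0 → ‖z‖ < r → z ∈ resolventSet ℂ a) (n : ℤ) :
    (2 * Real.pi * Complex.I : ℂ)⁻¹ • (∮ z in C(0, s), z ^ n • (z • resolvent a z - 1)) =
      laurentCoeff a s (n + 1) - if n = -1 then 1 else 0 := by
  have hd := fun n => ((differentiableOn_zpow_smul_resolvent hr n).continuousOn.mono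
    (sphere_subset hs hsr))
  have h1 : (∮ z in C(0, s), z ^ n • (z • resolvent a z - 1)) =
      ∮ z in C(0, s), (z ^ (n + 1) • resolvent a z - z ^ n • (1 : A)) := by
    refine circleIntegral.integral_congr hs.le fun z hz => ?_
    simp only [smul_sub, smul_smul]
    rw [zpow_add_one₀ (sphere_subset hs hsr hz).1]
  have h2 : ContinuousOn (fun z : ℂ => z ^ n • (1 : A)) (Metric.sphere 0 s) := by
    refine ContinuousOn.smul (fun z hz => ?_) continuousOn_const
    exact (continuousAt_zpow₀ z n (Or.inl (sphere_subset hs hsr hz).1)).continuousWithinAt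
  rw [h1, circleIntegral.integral_sub ((hd _).circleIntegrable hs.le) (h2.circleIntegrable hs.le),
    smul_sub, laurentCoeff, circleIntegral.integral_smul_const]
  congr 1
  split_ifs with hn
  · subst hn
    have := circleIntegral.integral_sub_center_inv 0 hs.ne'
    simp only [sub_zero] at this
    simp only [zpow_neg_one, this, smul_smul]
    rw [inv_mul_cancel₀ Complex.two_pi_I_ne_zero, one_smul]
  · have := circleIntegral.integral_sub_zpow_of_ne hn 0 0 s
    simp only [sub_zero] at this
    rw [this, zero_smul, smul_zero]

theorem mul_laurentCoeff {s : ℝ} (hs : 0 < s) (hsr : s < r)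
    (hr : ∀ z : ℂ, z ≠ 0 → ‖z‖ < r → z ∈ resolventSet ℂ a) (n : ℤ) :
    a * laurentCoeff a s n = laurentCoeff a s (n + 1) - if n = -1 then 1 else 0 := by
  rw [← circleIntegral_zpow_smul_sub hs hsr hr, laurentCoeff, mul_smul_comm]
  congr 1
  have hd := ((differentiableOn_zpow_smul_resolvent hr n).continuousOn.mono (sphere_subset hs hsr))
  refine (circleIntegral_clm_comp hs.le hd (ContinuousLinearMap.mul ℂ A a)).symm.trans ?_
  refine circleIntegral.integral_congr hs.le fun z hz => ?_
  have hz' := sphere_subset hs hsr hz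
  simp only [ContinuousLinearMap.mul_apply', mul_smul_comm, mul_resolvent (hr z hz'.1 hz'.2)]

theorem laurentCoeff_mul {s : ℝ} (hs : 0 < s) (hsr : s < r)
    (hr : ∀ z : ℂ, z ≠ 0 → ‖z‖ < r → z ∈ resolventSet ℂ a) (n : ℤ) :
    laurentCoeff a s n * a = laurentCoeff a s (n + 1) - if n = -1 then 1 else 0 := by
  rw [← circleIntegral_zpow_smul_sub hs hsr hr, laurentCoeff, smul_mul_assoc]
  congr 1
  have hd := ((differentiableOn_zpow_smul_resolvent hr n).continuousOn.mono (sphere_subset hs hsr))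
  refine (circleIntegral_clm_comp hs.le hd ((ContinuousLinearMap.mul ℂ A).flip a)).symm.trans ?_
  refine circleIntegral.integral_congr hs.le fun z hz => ?_
  have hz' := sphere_subset hs hsr hz
  simp only [ContinuousLinearMap.flip_apply, ContinuousLinearMap.mul_apply', smul_mul_assoc,
    resolvent_mul (hr z hz'.1 hz'.2)]

theorem commute_laurentCoeff {s : ℝ} (hs : 0 < s) (hsr : s < r)
    (hr : ∀ z : ℂ, z ≠ 0 → ‖z‖ < r → z ∈ resolventSet ℂ a) (n : ℤ) :
    Commute a (laurentCoeff a s n) :=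
  (mul_laurentCoeff hs hsr hr n).trans (laurentCoeff_mul hs hsr hr n).symm

theorem pow_mul_laurentCoeff_zero {s : ℝ} (hs : 0 < s) (hsr : s < r)
    (hr : ∀ z : ℂ, z ≠ 0 → ‖z‖ < r → z ∈ resolventSet ℂ a) (n : ℕ) :
    a ^ n * laurentCoeff a s 0 = laurentCoeff a s n := by
  induction n with
  | zero => simp
  | succ n ih =>
    rw [pow_succ', mul_assoc, ih, mul_laurentCoeff hs hsr hr, if_neg (by omega), sub_zero]
    rfl

/-- Climbing from index -(n + 1) to 0 passes the residue correction once, in the step from -1 to 0.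
-/
theorem pow_mul_laurentCoeff_neg {s : ℝ} (hs : 0 < s) (hsr : s < r)
    (hr : ∀ z : ℂ, z ≠ 0 → ‖z‖ < r → z ∈ resolventSet ℂ a) (n : ℕ) :
    a ^ (n + 1) * laurentCoeff a s (-(n + 1 : ℕ)) = laurentCoeff a s 0 - 1 := by
  induction n with
  | zero =>
    rw [zero_add, pow_one, mul_laurentCoeff hs hsr hr]
    simp
  | succ n ih =>
    rw [pow_succ, mul_assoc, mul_laurentCoeff hs hsr hr, if_neg (by omega), sub_zero, ← ih]
    congr 2

theorem exists_norm_laurentCoeff_le {s : ℝ} (hs : 0 < s) (hsr : s < r)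
    (hr : ∀ z : ℂ, z ≠ 0 → ‖z‖ < r → z ∈ resolventSet ℂ a) :
    ∃ C : ℝ, ∀ n : ℤ, ‖laurentCoeff a s n‖ ≤ C * s ^ n := by
  have hd := ((differentiableOn_zpow_smul_resolvent hr 0).continuousOn.mono (sphere_subset hs hsr))
  obtain ⟨C, hC⟩ := (isCompact_sphere (0 : ℂ) s).exists_bound_of_continuousOn hd
  refine ⟨s * C, fun n => ?_⟩
  have := circleIntegral.norm_two_pi_i_inv_smul_integral_le_of_norm_le_const (c := 0) (R := s)
    (C := s ^ n * C) (f := fun z => z ^ n • resolvent a z) hs.le (fun z hz => by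
      have h1 := hC z hz
      rw [zpow_zero, one_smul] at h1
      rw [mem_sphere_zero_iff_norm] at hz
      rw [norm_smul, norm_zpow, hz]
      gcongr)
  refine this.trans (le_of_eq (by ring))

/-- The freedom to shrink the contour makes the n-th coefficient, which is aⁿ times the spectral
idempotent, smaller than any geometric sequence. -/
theorem laurentCoeff_eq_of_le {s t : ℝ} (ht : 0 < t) (hts : t ≤ s) (hsr : s < r)
    (hr : ∀ z : ℂ, z ≠ 0 → ‖z‖ < r → z ∈ resolventSet ℂ a) (n : ℤ) :
    laurentCoeff a s n = laurentCoeff a t n := by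
  have hd := differentiableOn_zpow_smul_resolvent hr n
  have hopen : IsOpen {z : ℂ | z ≠ 0 ∧ ‖z‖ < r} :=
    isOpen_ne.inter (isOpen_lt continuous_norm continuous_const)
  rw [laurentCoeff, laurentCoeff,
    Complex.circleIntegral_eq_of_differentiable_on_annulus_off_countable ht hts
      Set.countable_empty (hd.continuousOn.mono ?_) ?_]
  · rintro z ⟨hz, hz'⟩
    rw [mem_closedBall_zero_iff] at hz
    rw [mem_ball_zero_iff, not_lt] at hz'
    exact ⟨norm_pos_iff.1 (ht.trans_le hz'), hz.trans_lt hsr⟩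
  · rintro z ⟨⟨hz, hz'⟩, -⟩
    rw [mem_ball_zero_iff] at hz
    rw [mem_closedBall_zero_iff, not_le] at hz'
    exact hd.differentiableAt (hopen.mem_nhds ⟨norm_pos_iff.1 (ht.trans hz'), hz.trans hsr⟩)

theorem eventually_isUnit_sub_smul (ha : IsUnit a) : ∀ᶠ z : ℂ in 𝓝 0, IsUnit (a - z • (1 : A)) := by
  have hcont : Continuous fun z : ℂ => a - z • (1 : A) := by fun_prop
  have h0 : a - (0 : ℂ) • (1 : A) ∈ {b : A | IsUnit b} := by simpa using ha
  exact hcont.continuousAt.preimage_mem_nhds (Units.isOpen.mem_nhds h0)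

end Resolvent

variable {X : Type*} [NormedAddCommGroup X] [NormedSpace ℂ X] [CompleteSpace X]
  {T : X →L[ℂ] X} {M E : Submodule ℂ X}

/-- The Riesz decomposition at an isolated point of the spectrum. -/
theorem IsGenDrazinInvertible.exists_isReduction (h : IsGenDrazinInvertible T) :
    ∃ M E : Submodule ℂ X, IsReduction T M E ∧ (∀ x ∈ M, T x = 0 → x = 0) ∧
      ∀ y ∈ M, ∃ x ∈ M, T x = y := by
  obtain ⟨r, hr0, hr⟩ : ∃ r : ℝ, 0 < r ∧ ∀ z : ℂ, z ≠ 0 → ‖z‖ < r → z ∈ resolventSet ℂ T := by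
    rw [IsGenDrazinInvertible, accPt_iff_frequently, not_frequently] at h
    obtain ⟨r, hr0, hr⟩ := Metric.eventually_nhds_iff.1 h
    refine ⟨r, hr0, fun z hz hzr => ?_⟩
    by_contra hmem
    exact hr (by simpa using hzr) ⟨hz, hmem⟩
  obtain ⟨s, hs, hsr⟩ : ∃ s : ℝ, 0 < s ∧ s < r := ⟨r / 2, by positivity, by linarith⟩
  set P := laurentCoeff T s 0 with hP
  have hTP : ∀ x, P (T x) = T (P x) := fun x =>
    (congrArg (fun A : X →L[ℂ] X => A x) (commute_laurentCoeff hs hsr hr 0).eq).symm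
  have hPH : ∀ x, P x ∈ quasinilpotentPart T := by
    refine fun x => mem_quasinilpotentPart_of_bound fun ε hε => ?_
    set t := min ε s with ht
    have ht0 : 0 < t := lt_min hε hs
    obtain ⟨C, hC⟩ := exists_norm_laurentCoeff_le ht0 ((min_le_right _ _).trans_lt hsr) hr
    refine ⟨max C 0 * ‖x‖, Eventually.of_forall fun n => ?_⟩
    have h1 : (T ^ n) (P x) = laurentCoeff T t n x := by
      rw [← laurentCoeff_eq_of_le ht0 (min_le_right _ _) hsr hr,
        ← pow_mul_laurentCoeff_zero hs hsr hr]
      rfl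
    rw [h1]
    calc ‖laurentCoeff T t n x‖ ≤ (C * t ^ (n : ℤ)) * ‖x‖ :=
          ContinuousLinearMap.le_of_opNorm_le _ (hC n) x
      _ ≤ (max C 0 * ε ^ n) * ‖x‖ := by
          rw [zpow_natCast]
          gcongr
          · exact le_max_left _ _
          · exact min_le_left _ _
      _ = max C 0 * ‖x‖ * ε ^ n := by ring
  -- On H₀(T), Px - x is the coefficient of index -(n + 1) applied to Tⁿ⁺¹x. The coefficient grows
  -- at most like s⁻⁽ⁿ⁺¹⁾ and the orbit is eventually below (s/2)ⁿ⁺¹, so the product tends to 0.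
  have hPid : ∀ x ∈ quasinilpotentPart T, P x = x := by
    intro x hx
    obtain ⟨C, hC⟩ := exists_norm_laurentCoeff_le hs hsr hr
    have hb : ∀ᶠ n : ℕ in atTop, ‖P x - x‖ ≤ max C 0 * (1 / 2 : ℝ) ^ n := by
      have := mem_quasinilpotentPart_iff.1 hx (s / 2) (by positivity)
      filter_upwards [this, eventually_ge_atTop 1] with n hn h1
      obtain ⟨n, rfl⟩ := Nat.exists_eq_add_of_le' h1
      have h2 : P x - x = laurentCoeff T s (-(n + 1 : ℕ)) ((T ^ (n + 1)) x) := by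
        change (P - 1) x = (laurentCoeff T s (-(n + 1 : ℕ)) * T ^ (n + 1)) x
        rw [← ((commute_laurentCoeff hs hsr hr _).pow_left (n + 1)).eq,
          pow_mul_laurentCoeff_neg hs hsr hr]
      rw [h2]
      calc _ ≤ (C * s ^ (-(n + 1 : ℕ) : ℤ)) * ‖(T ^ (n + 1)) x‖ :=
            ContinuousLinearMap.le_of_opNorm_le _ (hC _) _
        _ ≤ (max C 0 * s ^ (-(n + 1 : ℕ) : ℤ)) * (s / 2) ^ (n + 1) := by
            gcongr; exact le_max_left _ _
        _ = _ := by
            rw [zpow_neg, zpow_natCast, div_pow, one_div, inv_pow]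
            field_simp
    have hlim : Tendsto (fun n : ℕ => max C 0 * (1 / 2 : ℝ) ^ n) atTop (𝓝 0) := by
      simpa using (tendsto_pow_atTop_nhds_zero_of_lt_one (by norm_num : (0 : ℝ) ≤ 1 / 2)
        (by norm_num)).const_mul (max C 0)
    have := ge_of_tendsto hlim hb
    rw [← sub_eq_zero, ← norm_le_zero_iff]
    exact this
  have hidem : IsIdempotentElem P := by
    ext x
    exact hPid _ (hPH x)
  have hcompl := (ContinuousLinearMap.IsIdempotentElem.isTopCompl hidem).symm
  obtain ⟨hc, hcM, hcE⟩ := Submodule.isTopCompl_iff_isCompl_isClosed.1 hcompl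
  -- From TQ = QT = P - 1, the operator -Q inverts T on ker P. The preimage used below, PQy - Qy, is
  -- -Qy projected to ker P.
  set Q := laurentCoeff T s (-1) with hQ
  have hTQ : ∀ x, T (Q x) = P x - x := fun x => by
    have := mul_laurentCoeff hs hsr hr (-1)
    rw [if_pos rfl] at this
    exact congrArg (fun A : X →L[ℂ] X => A x) this
  have hQT : ∀ x, Q (T x) = P x - x := fun x => by
    rw [← hTQ]
    exact (congrArg (fun A : X →L[ℂ] X => A x) (commute_laurentCoeff hs hsr hr (-1)).eq).symm
  refine ⟨P.ker, P.range, ⟨fun x hx => ?_, ?_, hcM, hcE, hc, ?_⟩, fun x hx hTx => ?_,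
    fun y hy => ⟨P (Q y) - Q y, ?_, ?_⟩⟩
  · have hx' : P x = 0 := hx
    change P (T x) = 0
    rw [hTP, hx', map_zero]
  · rintro _ ⟨x, rfl⟩
    exact ⟨T x, hTP x⟩
  · rintro _ ⟨x, rfl⟩
    exact hPH x
  · have hx' : P x = 0 := hx
    have := hQT x
    rw [hTx, hx', map_zero, zero_sub] at this
    simpa using this
  · change P (P (Q y) - Q y) = 0
    rw [map_sub, hPid _ (hPH _), sub_self]
  · have hy' : P y = 0 := hy
    rw [map_sub, ← hTP, hTQ, hy', zero_sub, map_neg, hy']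
    simp

/-- On M, T - z stays invertible for small z because units form an open set; on E it is invertible
for every z ≠ 0. Hence a punctured disc about 0 misses the spectrum. -/
theorem IsReduction.isGenDrazinInvertible (h : IsReduction T M E)
    (hinj : ∀ x ∈ M, T x = 0 → x = 0) (hs : ∀ y ∈ M, ∃ x ∈ M, T x = y) :
    IsGenDrazinInvertible T := by
  have := h.isClosed_left.completeSpace_coe
  have := h.isClosed_right.completeSpace_coe
  have hA : IsUnit (T.restrict h.map_left) := by
    rw [ContinuousLinearMap.isUnit_iff_bijective]
    constructor
    · rw [injective_iff_map_eq_zero]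
      exact fun x hx => Subtype.ext (hinj x x.2 (congrArg Subtype.val hx))
    · rintro ⟨y, hy⟩
      obtain ⟨x, hx, hxy⟩ := hs y hy
      exact ⟨⟨x, hx⟩, Subtype.ext hxy⟩
  have hnear : ∀ᶠ z : ℂ in 𝓝 0, IsUnit (T.restrict h.map_left - z • 1) :=
    eventually_isUnit_sub_smul (A := M →L[ℂ] M) hA
  have hE : spectralRadius ℂ (T.restrict h.map_right) = 0 :=
    (isQuasinilpotent_restrict_iff h.isClosed_right h.map_right).2 h.right_le
  rw [IsGenDrazinInvertible, accPt_iff_frequently, not_frequently]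
  filter_upwards [hnear] with z hz
  rintro ⟨hz0, hmem⟩
  have hzE : IsUnit (algebraMap ℂ (E →L[ℂ] E) z - T.restrict h.map_right) :=
    spectrum.mem_resolventSet_of_spectralRadius_lt (by rw [hE]; simpa using hz0)
  rw [ContinuousLinearMap.isUnit_iff_bijective] at hz hzE
  refine hmem ?_
  change IsUnit _
  rw [ContinuousLinearMap.isUnit_iff_bijective]
  have happ : ∀ x, (algebraMap ℂ (X →L[ℂ] X) z - T) x = z • x - T x := fun x => rfl
  constructor
  · rw [injective_iff_map_eq_zero]
    intro x hx
    obtain ⟨m, hm, e, he, rfl⟩ := Submodule.mem_sup.1 (h.mem_sup x)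
    have hM : z • m - T m ∈ M := M.sub_mem (M.smul_mem z hm) (h.map_left m hm)
    have hE : z • e - T e ∈ E := E.sub_mem (E.smul_mem z he) (h.map_right e he)
    have hsum : (z • m - T m) + (z • e - T e) = 0 := by
      rw [happ, smul_add, map_add] at hx
      rw [← hx]; abel
    have h1 : z • m - T m = 0 := Submodule.disjoint_def.1 h.isCompl.disjoint _ hM
      (by rw [eq_neg_of_add_eq_zero_left hsum]; exact E.neg_mem hE)
    have h2 : z • e - T e = 0 := by rwa [h1, zero_add] at hsum
    have h3 : (⟨m, hm⟩ : M) = 0 := (injective_iff_map_eq_zero _).1 hz.1 _ (Subtype.ext (by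
      change T m - z • m = 0
      rw [← neg_sub, h1, neg_zero]))
    have h4 : (⟨e, he⟩ : E) = 0 := (injective_iff_map_eq_zero _).1 hzE.1 _ (Subtype.ext h2)
    rw [show m = 0 from congrArg Subtype.val h3, show e = 0 from congrArg Subtype.val h4, add_zero]
  · intro y
    obtain ⟨m, hm, e, he, rfl⟩ := Submodule.mem_sup.1 (h.mem_sup y)
    obtain ⟨m', hm'⟩ := hz.2 ⟨m, hm⟩
    obtain ⟨e', he'⟩ := hzE.2 ⟨e, he⟩
    have h1 : T m' - z • (m' : X) = m := congrArg Subtype.val hm'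
    have h2 : z • (e' : X) - T e' = e := congrArg Subtype.val he'
    -- The signs differ because m' was obtained from T - z and e' from z - T.
    refine ⟨e' - m', ?_⟩
    rw [happ, smul_sub, map_sub, ← h1, ← h2]
    abel

end PseudoBFredholm

/-! ### Comparison of the classes -/

namespace PseudoBFredholm

section

variable {X : Type*} [NormedAddCommGroup X] [NormedSpace ℂ X] {T : X →L[ℂ] X} {M E : Submodule ℂ X}

theorem HasSVEP.hasSVEPAt_sub_smul (hT : HasSVEP T) (μ : ℂ) :
    HasSVEPAt (T - μ • (1 : X →L[ℂ] X)) 0 := by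
  intro U hU h0 f hf hfz z hz
  have hcont : Continuous fun w : ℂ => w - μ := by fun_prop
  have h1 := hT μ ((fun w => w - μ) ⁻¹' U) (hU.preimage hcont) (by simpa using h0)
    (fun w => f (w - μ)) (fun w hw => AnalyticAt.fun_comp (hf (w - μ) hw) (by fun_prop))
    (fun w hw => by
      have := hfz (w - μ) hw
      simp only [sub_apply, smul_apply, one_apply_eq_self, sub_smul] at this ⊢
      rw [← this]; abel) (z + μ) (by simpa using hz)
  simpa using h1

theorem adjointOp_sub_smul (T : X →L[ℂ] X) (μ : ℂ) :
    adjointOp (T - μ • (1 : X →L[ℂ] X)) =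
      adjointOp T - μ • (1 : StrongDual ℂ X →L[ℂ] StrongDual ℂ X) := by
  ext φ x
  change φ (T x - μ • x) = φ (T x) - μ • φ x
  rw [map_sub, map_smul]

theorem index_nonpos {A : X →L[ℂ] X} (h : A.ker = ⊥) : index A ≤ 0 := by
  rw [index, h]
  simpa using EReal.coe_ennreal_nonneg _

theorem index_nonneg {A : X →L[ℂ] X} (h : A.range = ⊤) : 0 ≤ index A := by
  rw [index, h]
  simpa using EReal.coe_ennreal_nonneg _

theorem ker_restrict_eq_bot (h : ∀ x ∈ M, T x ∈ M) (hinj : ∀ x ∈ M, T x = 0 → x = 0) :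
    (T.restrict h).ker = ⊥ := by
  rw [LinearMap.ker_eq_bot']
  exact fun x hx => Subtype.ext (hinj x x.2 (congrArg Subtype.val hx))

theorem range_restrict_eq_top (h : ∀ x ∈ M, T x ∈ M) (hs : ∀ y ∈ M, ∃ x ∈ M, T x = y) :
    (T.restrict h).range = ⊤ := by
  rw [LinearMap.range_eq_top]
  rintro ⟨y, hy⟩
  obtain ⟨x, hx, hxy⟩ := hs y hy
  exact ⟨⟨x, hx⟩, Subtype.ext hxy⟩

theorem isClosed_range_restrict_iff (hM : IsClosed (M : Set X)) (h : ∀ x ∈ M, T x ∈ M) :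
    IsClosed ((T.restrict h).range : Set M) ↔ IsClosed (M.map T.toLinearMap : Set X) := by
  rw [hM.isClosedEmbedding_subtypeVal.isClosed_iff_image_isClosed]
  have : Subtype.val '' ((T.restrict h).range : Set M) = (M.map T.toLinearMap : Set X) := by
    ext y
    constructor
    · rintro ⟨_, ⟨x, rfl⟩, rfl⟩
      exact ⟨x, x.2, rfl⟩
    · rintro ⟨x, hx, rfl⟩
      exact ⟨_, ⟨⟨x, hx⟩, rfl⟩, rfl⟩
  rw [← this]
  rfl

theorem finiteDimensional_ker_inf (h : ∀ x ∈ M, T x ∈ M)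
    (hfd : FiniteDimensional ℂ (T.restrict h).ker) :
    FiniteDimensional ℂ (T.ker ⊓ M : Submodule ℂ X) := by
  have : (T.ker ⊓ M : Submodule ℂ X) ≤ (T.restrict h).ker.map M.subtype := by
    rintro x ⟨hx, hxM⟩
    exact ⟨⟨x, hxM⟩, Subtype.ext hx, rfl⟩
  exact Submodule.finiteDimensional_of_le this

/-- Codimension is moved from M to X so that the induction in `exists_surjective` can vary M and E
inside a fixed space. -/
theorem IsReduction.finiteDimensional_quotient (h : IsReduction T M E)
    (hfd : FiniteDimensional ℂ (M ⧸ (T.restrict h.map_left).range)) :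
    FiniteDimensional ℂ (X ⧸ (M.map T.toLinearMap ⊔ E)) := by
  have hle : (T.restrict h.map_left).range ≤
      (M.map T.toLinearMap ⊔ E).comap M.subtype := by
    rintro _ ⟨x, rfl⟩
    exact Submodule.mem_sup_left ⟨x, x.2, rfl⟩
  refine Module.Finite.of_surjective (Submodule.mapQ _ _ M.subtype hle) fun y => ?_
  obtain ⟨x, rfl⟩ := Submodule.mkQ_surjective _ y
  obtain ⟨m, hm, e, he, rfl⟩ := Submodule.mem_sup.1
    (h.isCompl.sup_eq_top ▸ Submodule.mem_top : x ∈ M ⊔ E)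
  refine ⟨Submodule.mkQ _ ⟨m, hm⟩, ?_⟩
  have : (M.map T.toLinearMap ⊔ E).mkQ e = 0 :=
    (Submodule.Quotient.mk_eq_zero _).2 (Submodule.mem_sup_right he)
  rw [map_add, this, add_zero]
  rfl

theorem spectrumOf_congr {P Q : (X →L[ℂ] X) → Prop}
    (h : ∀ μ : ℂ, P (T - μ • (1 : X →L[ℂ] X)) ↔ Q (T - μ • (1 : X →L[ℂ] X))) :
    spectrumOf P T = spectrumOf Q T :=
  Set.ext fun μ => not_congr (h μ)

end

variable {X : Type*} [NormedAddCommGroup X] [NormedSpace ℂ X] [CompleteSpace X]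
  {T : X →L[ℂ] X} {M E : Submodule ℂ X}

/-- T is bounded below on M, so a nonzero orbit there decays at most geometrically and M ∩ H₀(T) =
0. -/
theorem IsReduction.quasinilpotentPart_eq (h : IsReduction T M E)
    (hTM : IsClosed (M.map T.toLinearMap : Set X)) (hinj : ∀ x ∈ M, T x = 0 → x = 0) :
    quasinilpotentPart T = E := by
  have := h.isClosed_left.completeSpace_coe
  refine le_antisymm (fun x hx => ?_) h.right_le
  obtain ⟨m, hm, e, he, rfl⟩ := Submodule.mem_sup.1 (h.mem_sup x)
  have hmH : m ∈ quasinilpotentPart T := by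
    simpa using (quasinilpotentPart T).sub_mem hx (h.right_le he)
  obtain ⟨K, hK⟩ := (T.restrict h.map_left).antilipschitz_of_injective_of_isClosed_range
    (LinearMap.ker_eq_bot.1 (ker_restrict_eq_bot h.map_left hinj))
    ((isClosed_range_restrict_iff h.isClosed_left h.map_left).2 hTM)
  -- K may be 0; K + 1 keeps the rate (2(K + 1))⁻¹ positive.
  have hb : ∀ y ∈ M, ‖y‖ ≤ (K + 1 : ℝ) * ‖T y‖ := fun y hy => by
    have h1 : ‖y‖ ≤ K * ‖T y‖ := ContinuousLinearMap.bound_of_antilipschitz _ hK ⟨y, hy⟩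
    nlinarith [norm_nonneg (T y)]
  have hbn : ∀ n : ℕ, ‖m‖ ≤ (K + 1 : ℝ) ^ n * ‖(T ^ n) m‖ := by
    intro n
    induction n with
    | zero => simp
    | succ n ih =>
      calc ‖m‖ ≤ (K + 1 : ℝ) ^ n * ‖(T ^ n) m‖ := ih
        _ ≤ (K + 1 : ℝ) ^ n * ((K + 1 : ℝ) * ‖T ((T ^ n) m)‖) := by
          gcongr; exact hb _ (pow_mem h.map_left n hm)
        _ = _ := by rw [pow_succ_apply]; ring
  have hlim : Tendsto (fun n : ℕ => (1 / 2 : ℝ) ^ n) atTop (𝓝 0) :=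
    tendsto_pow_atTop_nhds_zero_of_lt_one (by norm_num) (by norm_num)
  have hm0 : ‖m‖ ≤ 0 := by
    refine ge_of_tendsto hlim ?_
    filter_upwards [mem_quasinilpotentPart_iff.1 hmH ((2 * (K + 1))⁻¹) (by positivity)] with n hn
    calc ‖m‖ ≤ (K + 1 : ℝ) ^ n * ‖(T ^ n) m‖ := hbn n
      _ ≤ (K + 1 : ℝ) ^ n * ((2 * ((K : ℝ) + 1))⁻¹) ^ n := by gcongr
      _ = (1 / 2 : ℝ) ^ n := by rw [← mul_pow]; congr 1; field_simp
  rw [norm_le_zero_iff.1 hm0, zero_add]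
  exact he

/-- The E-components vₙ of a backward orbit satisfy v₀ = Tⁿvₙ. They grow at most like cⁿ, while Tⁿ
on E is O((2c)⁻ⁿ), so v₀ = 0. -/
theorem IsReduction.analyticCore_eq (h : IsReduction T M E)
    (hs : ∀ y ∈ M, ∃ x ∈ M, T x = y) : analyticCore T = M := by
  refine le_antisymm ?_ (le_analyticCore h.isClosed_left h.map_left hs)
  rintro x ⟨c, hc, u, rfl, hu, hb⟩
  obtain ⟨P, hPM, -, -, hPE, hPT⟩ := h.exists_projection
  obtain ⟨C, hC⟩ := exists_pow_bound h.isClosed_right h.right_le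
    (ε := (2 * c)⁻¹) (by positivity)
  let v : ℕ → X := fun n => u n - P (u n)
  have hv : ∀ n, (T ^ n) (v n) = v 0 := by
    intro n
    induction n with
    | zero => simp
    | succ n ih =>
      have h1 : T (v (n + 1)) = v n := by
        simp only [v, map_sub, ← hPT, hu]
      rw [pow_succ, ← ih, ← h1]
      rfl
  set D := ‖(1 : X →L[ℂ] X) - P‖ with hD
  have hlim : Tendsto (fun n : ℕ => max C 0 * D * ‖u 0‖ * (1 / 2 : ℝ) ^ n) atTop (𝓝 0) := by
    simpa using (tendsto_pow_atTop_nhds_zero_of_lt_one (by norm_num : (0 : ℝ) ≤ 1 / 2)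
      (by norm_num)).const_mul (max C 0 * D * ‖u 0‖)
  have h0 : ‖v 0‖ ≤ 0 := by
    refine ge_of_tendsto' hlim fun n => ?_
    calc ‖v 0‖ = ‖(T ^ n) (v n)‖ := by rw [hv]
      _ ≤ C * ((2 * c)⁻¹) ^ n * ‖v n‖ := hC n _ (hPE _)
      _ ≤ max C 0 * ((2 * c)⁻¹) ^ n * (D * (c ^ n * ‖u 0‖)) := by
          gcongr
          · exact le_max_left _ _
          · calc ‖v n‖ ≤ D * ‖u n‖ := ((1 : X →L[ℂ] X) - P).le_opNorm (u n)
              _ ≤ _ := by gcongr; exact hb n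
      _ = max C 0 * D * ‖u 0‖ * (((2 * c)⁻¹) ^ n * c ^ n) := by ring
      _ = max C 0 * D * ‖u 0‖ * (1 / 2 : ℝ) ^ n := by
          rw [← mul_pow]; congr 2; field_simp
  have h1 : u 0 = P (u 0) := sub_eq_zero.1 (norm_le_zero_iff.1 h0)
  rw [h1]
  exact hPM _

theorem isLeftGenDrazinInvertible_iff : IsLeftGenDrazinInvertible T ↔
    ∃ M E : Submodule ℂ X, IsReduction T M E ∧ (∀ x ∈ M, T x = 0 → x = 0) ∧
      IsClosed (M.map T.toLinearMap : Set X) := by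
  constructor
  · rintro ⟨hH, M, hM, hTM, hc, hcl⟩
    refine ⟨M, _, ⟨hTM, fun x hx => map_mem_quasinilpotentPart hx, hM, hH, hc.symm, le_rfl⟩,
      fun x hx h0 => ?_, hcl⟩
    exact Submodule.disjoint_def.1 hc.disjoint _
      (mem_quasinilpotentPart_of_pow_eq_zero (p := 1) (by simpa using h0)) hx
  · rintro ⟨M, E, h, hinj, hcl⟩
    have hE := h.quasinilpotentPart_eq hcl hinj
    rw [IsLeftGenDrazinInvertible, hE]
    exact ⟨h.isClosed_right, M, h.isClosed_left, h.map_left, h.isCompl.symm, hcl⟩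

theorem isRightGenDrazinInvertible_iff : IsRightGenDrazinInvertible T ↔
    ∃ M E : Submodule ℂ X, IsReduction T M E ∧ ∀ y ∈ M, ∃ x ∈ M, T x = y := by
  constructor
  · rintro ⟨hK, N, hN, hTN, hc, hle⟩
    exact ⟨_, N, ⟨fun x hx => map_mem_analyticCore hx, hTN, hK, hN, hc, hle⟩,
      fun y hy => exists_mem_analyticCore_map_eq hy⟩
  · rintro ⟨M, E, h, hs⟩
    rw [IsRightGenDrazinInvertible, h.analyticCore_eq hs]
    exact ⟨h.isClosed_left, E, h.isClosed_right, h.map_right, h.isCompl, h.right_le⟩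

theorem IsLeftGenDrazinInvertible.isPseudoUpperSemiBWeyl (h : IsLeftGenDrazinInvertible T) :
    IsPseudoUpperSemiBWeyl T := by
  obtain ⟨M, E, h, hinj, hcl⟩ := isLeftGenDrazinInvertible_iff.1 h
  have hk := ker_restrict_eq_bot h.map_left hinj
  refine isSumWithQuasinilpotent_iff.2 ⟨M, E, h, ⟨?_, ?_⟩, index_nonpos hk⟩
  · rw [hk]; infer_instance
  · exact (isClosed_range_restrict_iff h.isClosed_left h.map_left).2 hcl

theorem IsPseudoUpperSemiBWeyl.isPseudoUpperSemiBFredholm (h : IsPseudoUpperSemiBWeyl T) :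
    IsPseudoUpperSemiBFredholm T := by
  obtain ⟨M, E, h, hP, -⟩ := isSumWithQuasinilpotent_iff.1 h
  exact isSumWithQuasinilpotent_iff.2 ⟨M, E, h, hP⟩

theorem IsPseudoUpperSemiBFredholm.isLeftGenDrazinInvertible (h : IsPseudoUpperSemiBFredholm T)
    (hT : HasSVEPAt T 0) : IsLeftGenDrazinInvertible T := by
  obtain ⟨M, E, h, hk, hcl⟩ := isSumWithQuasinilpotent_iff.1 h
  exact isLeftGenDrazinInvertible_iff.2 (h.exists_injective hT
    ((isClosed_range_restrict_iff h.isClosed_left h.map_left).1 hcl)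
    (finiteDimensional_ker_inf h.map_left hk))

theorem IsRightGenDrazinInvertible.isPseudoLowerSemiBWeyl (h : IsRightGenDrazinInvertible T) :
    IsPseudoLowerSemiBWeyl T := by
  obtain ⟨M, E, h, hs⟩ := isRightGenDrazinInvertible_iff.1 h
  have hr := range_restrict_eq_top h.map_left hs
  refine isSumWithQuasinilpotent_iff.2 ⟨M, E, h, ?_, index_nonneg hr⟩
  rw [IsLowerSemiFredholm, hr]
  infer_instance

theorem IsPseudoLowerSemiBWeyl.isPseudoLowerSemiBFredholm (h : IsPseudoLowerSemiBWeyl T) :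
    IsPseudoLowerSemiBFredholm T := by
  obtain ⟨M, E, h, hP, -⟩ := isSumWithQuasinilpotent_iff.1 h
  exact isSumWithQuasinilpotent_iff.2 ⟨M, E, h, hP⟩

theorem IsPseudoLowerSemiBFredholm.isRightGenDrazinInvertible (h : IsPseudoLowerSemiBFredholm T)
    (hT : HasSVEPAt (adjointOp T) 0) : IsRightGenDrazinInvertible T := by
  obtain ⟨M, E, h, hfd⟩ := isSumWithQuasinilpotent_iff.1 h
  exact isRightGenDrazinInvertible_iff.2
    (h.exists_surjective hT (h.finiteDimensional_quotient hfd))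

theorem IsLeftGenDrazinInvertible.isGenDrazinInvertible (h : IsLeftGenDrazinInvertible T)
    (hT : HasSVEPAt (adjointOp T) 0) : IsGenDrazinInvertible T := by
  obtain ⟨M, E, h, hinj, hcl⟩ := isLeftGenDrazinInvertible_iff.1 h
  exact h.isGenDrazinInvertible hinj (h.surjective_of_injective hT hcl hinj)

theorem IsRightGenDrazinInvertible.isGenDrazinInvertible (h : IsRightGenDrazinInvertible T)
    (hT : HasSVEPAt T 0) : IsGenDrazinInvertible T := by
  obtain ⟨M, E, h, hs⟩ := isRightGenDrazinInvertible_iff.1 h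
  exact h.isGenDrazinInvertible (fun x hx h0 => eq_zero_of_mem_ker_of_mem_analyticCore hT h0
    (le_analyticCore h.isClosed_left h.map_left hs hx)) hs

theorem IsGenDrazinInvertible.isRightGenDrazinInvertible (h : IsGenDrazinInvertible T) :
    IsRightGenDrazinInvertible T := by
  obtain ⟨M, E, h, -, hs⟩ := h.exists_isReduction
  exact isRightGenDrazinInvertible_iff.2 ⟨M, E, h, hs⟩

theorem IsGenDrazinInvertible.isLeftGenDrazinInvertible (h : IsGenDrazinInvertible T) :
    IsLeftGenDrazinInvertible T := by
  obtain ⟨M, E, h, hinj, hs⟩ := h.exists_isReduction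
  refine isLeftGenDrazinInvertible_iff.2 ⟨M, E, h, hinj, ?_⟩
  have : M.map T.toLinearMap = M :=
    le_antisymm (Submodule.map_le_iff_le_comap.2 h.map_left) hs
  rw [this]
  exact h.isClosed_left

theorem IsGenDrazinInvertible.isPseudoBWeyl (h : IsGenDrazinInvertible T) : IsPseudoBWeyl T := by
  obtain ⟨M, E, h, hinj, hs⟩ := h.exists_isReduction
  have := h.isClosed_left.completeSpace_coe
  have hk := ker_restrict_eq_bot h.map_left hinj
  have hr := range_restrict_eq_top h.map_left hs
  refine isSumWithQuasinilpotent_iff.2 ⟨M, E, h, ⟨?_, ?_, ?_, ?_, ?_⟩,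
    le_antisymm (index_nonpos hk) (index_nonneg hr)⟩
  · exact ((T.restrict h.map_left).isOpenMap (LinearMap.range_eq_top.1 hr)).isStrictMap
      (T.restrict h.map_left).continuous
  · rw [hr]; exact isClosed_univ
  · rw [hk]; infer_instance
  · rw [hr]; infer_instance
  · rw [hk]; exact Submodule.closedComplemented_bot

theorem IsPseudoBWeyl.isPseudoBFredholm (h : IsPseudoBWeyl T) : IsPseudoBFredholm T := by
  obtain ⟨M, E, h, hP, -⟩ := isSumWithQuasinilpotent_iff.1 h
  exact isSumWithQuasinilpotent_iff.2 ⟨M, E, h, hP⟩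

theorem IsPseudoBFredholm.isPseudoUpperSemiBFredholm (h : IsPseudoBFredholm T) :
    IsPseudoUpperSemiBFredholm T := by
  obtain ⟨M, E, h, hP⟩ := isSumWithQuasinilpotent_iff.1 h
  exact isSumWithQuasinilpotent_iff.2 ⟨M, E, h, hP.finite_ker, hP.isClosed_range⟩

end PseudoBFredholm

/-! ### The equalities of spectra -/

open PseudoBFredholm in
theorem mainTheorem6 {X : Type*} [NormedAddCommGroup X] [NormedSpace ℂ X] [CompleteSpace X]
    (T : X →L[ℂ] X) :
    (PseudoBFredholm.HasSVEP T →
      PseudoBFredholm.sigma_lgD T = PseudoBFredholm.sigma_pBuF T ∧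
      PseudoBFredholm.sigma_pBuF T = PseudoBFredholm.sigma_pBuW T) ∧
    (PseudoBFredholm.HasSVEP (PseudoBFredholm.adjointOp T) →
      PseudoBFredholm.sigma_rgD T = PseudoBFredholm.sigma_pBlF T ∧
      PseudoBFredholm.sigma_pBlF T = PseudoBFredholm.sigma_pBlW T) ∧
    (PseudoBFredholm.HasSVEP T → PseudoBFredholm.HasSVEP (PseudoBFredholm.adjointOp T) →
      PseudoBFredholm.sigma_lgD T = PseudoBFredholm.sigma_gD T ∧
      PseudoBFredholm.sigma_pBuF T = PseudoBFredholm.sigma_gD T ∧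
      PseudoBFredholm.sigma_pBuW T = PseudoBFredholm.sigma_gD T ∧
      PseudoBFredholm.sigma_rgD T = PseudoBFredholm.sigma_gD T ∧
      PseudoBFredholm.sigma_pBlF T = PseudoBFredholm.sigma_gD T ∧
      PseudoBFredholm.sigma_pBlW T = PseudoBFredholm.sigma_gD T ∧
      PseudoBFredholm.sigma_pBF T = PseudoBFredholm.sigma_gD T ∧
      PseudoBFredholm.sigma_pBW T = PseudoBFredholm.sigma_gD T) := by
  have hadj : HasSVEP (adjointOp T) → ∀ μ : ℂ,
      HasSVEPAt (adjointOp (T - μ • (1 : X →L[ℂ] X))) 0 := fun h μ => by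
    rw [adjointOp_sub_smul]
    exact h.hasSVEPAt_sub_smul μ
  have upper : HasSVEP T → sigma_lgD T = sigma_pBuF T ∧ sigma_pBuF T = sigma_pBuW T := fun h =>
    ⟨spectrumOf_congr fun μ =>
      ⟨fun hl => hl.isPseudoUpperSemiBWeyl.isPseudoUpperSemiBFredholm,
        fun hF => hF.isLeftGenDrazinInvertible (h.hasSVEPAt_sub_smul μ)⟩,
    spectrumOf_congr fun μ =>
      ⟨fun hF => (hF.isLeftGenDrazinInvertible (h.hasSVEPAt_sub_smul μ)).isPseudoUpperSemiBWeyl,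
        fun hW => hW.isPseudoUpperSemiBFredholm⟩⟩
  have lower : HasSVEP (adjointOp T) → sigma_rgD T = sigma_pBlF T ∧ sigma_pBlF T = sigma_pBlW T :=
    fun h =>
    ⟨spectrumOf_congr fun μ =>
      ⟨fun hl => hl.isPseudoLowerSemiBWeyl.isPseudoLowerSemiBFredholm,
        fun hF => hF.isRightGenDrazinInvertible (hadj h μ)⟩,
    spectrumOf_congr fun μ =>
      ⟨fun hF => (hF.isRightGenDrazinInvertible (hadj h μ)).isPseudoLowerSemiBWeyl,
        fun hW => hW.isPseudoLowerSemiBFredholm⟩⟩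
  refine ⟨upper, lower, fun h h' => ?_⟩
  have left_eq : sigma_lgD T = sigma_gD T := spectrumOf_congr fun μ =>
    ⟨fun hl => hl.isGenDrazinInvertible (hadj h' μ), fun hg => hg.isLeftGenDrazinInvertible⟩
  have right_eq : sigma_rgD T = sigma_gD T := spectrumOf_congr fun μ =>
    ⟨fun hr => hr.isGenDrazinInvertible (h.hasSVEPAt_sub_smul μ),
      fun hg => hg.isRightGenDrazinInvertible⟩
  -- The SVEP of T makes the Fredholm part injective with closed range after shrinking M; the SVEP
  -- of T* then makes it surjective.
  have fredholm_imp : ∀ μ : ℂ, IsPseudoBFredholm (T - μ • (1 : X →L[ℂ] X)) →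
      IsGenDrazinInvertible (T - μ • (1 : X →L[ℂ] X)) := fun μ hF =>
    (hF.isPseudoUpperSemiBFredholm.isLeftGenDrazinInvertible
      (h.hasSVEPAt_sub_smul μ)).isGenDrazinInvertible (hadj h' μ)
  obtain ⟨u1, u2⟩ := upper h
  obtain ⟨l1, l2⟩ := lower h'
  exact ⟨left_eq, u1.symm.trans left_eq, u2.symm.trans (u1.symm.trans left_eq),
    right_eq, l1.symm.trans right_eq, l2.symm.trans (l1.symm.trans right_eq),
    spectrumOf_congr fun μ => ⟨fredholm_imp μ, fun hg => hg.isPseudoBWeyl.isPseudoBFredholm⟩,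
    spectrumOf_congr fun μ => ⟨fun hW => fredholm_imp μ hW.isPseudoBFredholm,
      fun hg => hg.isPseudoBWeyl⟩⟩
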